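/- **Conventions.** Fix an optimal decompressor. $C(x)$, $C(x|y)$ denote plain and conditional Kolmogorov complexity of binary strings; $C(x,y)$ and $C(\cdot|y,w)$ refer to a standard code of the pair. Put $I(u:v)=C(v)-C(v|u)$ and $I(u:v|z)=C(v|z)-C(v|u,z)$. For strings $x,y,w$ let $N=|x|+|y|+|w|$ be the sum of their lengths; $A\lesssim B$ means $A\le B+O(\log N)$ (with $\log (N+2)$ in place of $\log N$, to be meaningful for small $N$), $A\gtrsim B$ means $B\lesssim A$, and $A\approx B$ means both. **Graphs.** Consider an explicit family of bipartite graphs $G=G_{k,d}=(L,R;E)$ whose vertices are binary strings: the complete lists of vertices and edges can be found algorithmically given $k$ and $d$. Let $d\ge 1$, let $q$ be a positive integer with $k=\lfloor\log_2 q\rfloor$, let $n=\log_2 q$ (for $q=2^k$ this is $n=k$), and suppose that $|L|=q^2$, $|R|=q^{d+1}$, every vertex in $L$ has degree $q^d$, every vertex in $R$ has degree $q$, and $G$ is a good spectral expander, i.e., the second largest eigenvalue of its adjacency matrix (with multiplicities) satisfies $\lambda_2\le\sqrt{\max\{q^d,q\}}$. **Corollary 1.** Let $(x,y)\in E$ be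 a typical edge of $G$, i.e., $$C(x)\approx 2n,\qquad C(y)\approx (d+1)n,\qquad C(x,y)\approx (d+2)n,$$ and let $w$ be a binary string such that $I(w:x)\gtrsim n$ and $I(w:y|x)\approx 0$. Then $$C(x|y,w)\approx 0.$$ Here the constant in the $O(\log N)$ of the conclusion depends only on the decompressor, on the family of graphs and on the constants in the $O(\log N)$ terms of the hypotheses (not on $k,d,q,x,y,w$). -/

import Mathlib

namespace KolmogorovMixing

/-! ## Plain Kolmogorov complexity -/

/-- A decompressor (description mode): it receives a program and a condition, both of them
bit strings, and produces a bit string, if it halts. -/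
abbrev Decompressor : Type := List Bool → List Bool →. List Bool

/-- An optimal decompressor: it is partial computable, and it needs at most `O(1)` more bits than
any other partial computable decompressor. -/
def IsOptimal (U : Decompressor) : Prop :=
  Partrec₂ U ∧ ∀ D : Decompressor, Partrec₂ D →
    ∃ c : ℕ, ∀ p y x : List Bool, x ∈ D p y →
      ∃ p' : List Bool, x ∈ U p' y ∧ p'.length ≤ p.length + c

/-- Conditional Kolmogorov complexity `C(x|y)`: the length of a shortest program that produces `x`
from `y`. (For an optimal `U` such a program always exists.) -/
noncomputable def condC (U : Decompressor) (x y : List Bool) : ℕ :=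
  sInf {l : ℕ | ∃ p : List Bool, x ∈ U p y ∧ p.length = l}

/-- Kolmogorov complexity `C(x)`, the condition being the empty string. -/
noncomputable def plainC (U : Decompressor) (x : List Bool) : ℕ := condC U x []

/-- The code of a pair of strings: all bits of the first string doubled, then the
separator `01`, then the second string. -/
def pairCode (x y : List Bool) : List Bool :=
  x.flatMap (fun b => [b, b]) ++ false :: true :: y

/-- Mutual information `I(x:y) = C(y) - C(y|x)`. -/
noncomputable def mutualInfo (U : Decompressor) (x y : List Bool) : ℝ :=
  (plainC U y : ℝ) - condC U y x

/-- Conditional mutual information `I(x:y|z) = C(y|z) - C(y|x,z)`. -/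
noncomputable def condMutualInfo (U : Decompressor) (x y z : List Bool) : ℝ :=
  (condC U y z : ℝ) - condC U y (pairCode x z)

/-- `A ≤ B + O(log N)` with the constant `c` in the `O`. The logarithm is taken of `N + 2`
so that it is at least `1` for every `N`. -/
def LogLE (c : ℝ) (N : ℕ) (A B : ℝ) : Prop := A ≤ B + c * Real.logb 2 (N + 2)

/-- `A = B ± O(log N)` with the constant `c` in the `O`. -/
def LogEq (c : ℝ) (N : ℕ) (A B : ℝ) : Prop := LogLE c N A B ∧ LogLE c N B A

/-! ## Bipartite graphs on bit strings -/

/-- A finite bipartite graph `(L, R; E)` whose vertices are (named by) bit strings. The set of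
vertices is the disjoint union of `L` and `R`. -/
structure BipartiteGraph where
  L : Finset (List Bool)
  R : Finset (List Bool)
  E : Finset (List Bool × List Bool)
  E_subset : E ⊆ L ×ˢ R

namespace BipartiteGraph

/-- All vertices in `L` have degree `DL`, all vertices in `R` have degree `DR`. -/
def IsBiregular (G : BipartiteGraph) (DL DR : ℕ) : Prop :=
  (∀ x ∈ G.L, (G.R.filter fun y => (x, y) ∈ G.E).card = DL) ∧
  (∀ y ∈ G.R, (G.L.filter fun x => (x, y) ∈ G.E).card = DR)

/-- The block of the adjacency matrix with rows in `L` and columns in `R`. -/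
def biadjacency (G : BipartiteGraph) : Matrix G.L G.R ℝ :=
  Matrix.of fun x y => if (x.1, y.1) ∈ G.E then 1 else 0

/-- The adjacency matrix, of size `|L| + |R|`. -/
def adjacency (G : BipartiteGraph) : Matrix (G.L ⊕ G.R) (G.L ⊕ G.R) ℝ :=
  Matrix.fromBlocks 0 G.biadjacency G.biadjacency.transpose 0

theorem adjacency_isHermitian (G : BipartiteGraph) : G.adjacency.IsHermitian := by
  unfold adjacency
  rw [Matrix.isHermitian_fromBlocks_iff]
  refine ⟨Matrix.isHermitian_zero, ?_, ?_, Matrix.isHermitian_zero⟩ <;>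
    ext i j <;> simp

/-- A good spectral bipartite expander with degrees `DL` and `DR`: the second one of the
eigenvalues `λ₁ ≥ λ₂ ≥ ⋯` (with multiplicities) of the adjacency matrix is at most
`√(max DL DR)`. -/
def IsGoodSpectralExpander (G : BipartiteGraph) (DL DR : ℕ) : Prop :=
  G.IsBiregular DL DR ∧
  ∃ h : 1 < Fintype.card (G.L ⊕ G.R),
    G.adjacency_isHermitian.eigenvalues₀ ⟨1, h⟩ ≤ Real.sqrt (max DL DR : ℕ)

/-- `|L| = q²`, `|R| = q^(d+1)`, degree `q^d` on the left and degree `q` on the right. -/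
def HasParameters (G : BipartiteGraph) (q d : ℕ) : Prop :=
  G.L.card = q ^ 2 ∧ G.R.card = q ^ (d + 1) ∧ G.IsBiregular (q ^ d) q

end BipartiteGraph

/-- A family of graphs is given explicitly: there are algorithms that find the complete lists of
vertices and edges of `G k d` from the parameters `k` and `d`. -/
def IsExplicit (G : ℕ → ℕ → BipartiteGraph) : Prop :=
  ∃ (l r : ℕ → ℕ → List (List Bool)) (e : ℕ → ℕ → List (List Bool × List Bool)),
    Computable₂ l ∧ Computable₂ r ∧ Computable₂ e ∧
    ∀ k d, (l k d).toFinset = (G k d).L ∧ (r k d).toFinset = (G k d).R ∧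
      (e k d).toFinset = (G k d).E

/-- The complexity profile of a typical edge, up to `c * log N`, with `n = log q`:
`C(x) = 2n`, `C(y) = (d+1)n`, `C(x,y) = (d+2)n`. -/
def HasTypicalProfile (U : Decompressor) (c : ℝ) (N q d : ℕ) (x y : List Bool) : Prop :=
  LogEq c N (plainC U x) (2 * Real.logb 2 q) ∧
  LogEq c N (plainC U y) ((d + 1) * Real.logb 2 q) ∧
  LogEq c N (plainC U (pairCode x y)) ((d + 2) * Real.logb 2 q)

end KolmogorovMixing

open KolmogorovMixing

/-! Put a = C(x|w) and let A be the set of left vertices x' with C(x'|w) ≤ a, so that |A| ≤ 2^(a+1).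
Up to factors of two, let 2^m be the number of neighbours of y in A, B the set of right vertices
with at least 2^m neighbours in A, 2^t the number of neighbours of x in B, A' the set of vertices of
A with at least 2^t neighbours in B, and 2^r = |A'|. Given w and a few numbers of logarithmic
length, all these sets can be enumerated, so an element can be named by its index. Up to O(log N)
this gives C(x|y,w) ≤ m, C(y|w,x) ≤ t and C(x|w) ≤ r (`IsOptimal.exists_mixing_profile`, resting on
`IsOptimal.condC_le_of_enumerable`). It remains to show that m is O(log N).

There are at least |B|·2^m and at least |A'|·2^t edges between A and B, while the expander mixing
lemma (`BipartiteGraph.mixing`) allows at most |A||B|/q + √(q^d |A||B|). If the first term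
dominates, then m ≲ a - n, and a ≲ n because C(x) ≲ 2n and I(w:x) ≳ n. If the second dominates,
eliminating |B| gives r + t + m ≲ a + dn (`BipartiteGraph.HasParameters.mixing_bound`). Here r ≳ a,
and t ≳ C(y|w,x) ≳ C(y|x) ≳ C(x,y) - C(x) ≳ dn, by the hypothesis on I(w:y|x) and the easy half of
the chain rule. In both cases m ≲ 0. -/

namespace KolmogorovMixing

/-! ### Spectral gap and the expander mixing lemma -/

open Matrix in
/-- If `u` is an eigenvector whose eigenvalue exceeds the second eigenvalue of a Hermitian matrix,
then on the orthogonal complement of `u` the quadratic form is bounded by the second eigenvalue. -/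
theorem dotProduct_mulVec_le_of_orthogonal {n : Type*} [Fintype n] [DecidableEq n]
    {A : Matrix n n ℝ} (hA : A.IsHermitian) (h : 1 < Fintype.card n) {u v : n → ℝ} {μ lam : ℝ}
    (hu0 : u ≠ 0) (hu : A *ᵥ u = μ • u) (hlam : hA.eigenvalues₀ ⟨1, h⟩ ≤ lam) (hμ : lam < μ)
    (huv : u ⬝ᵥ v = 0) : v ⬝ᵥ (A *ᵥ v) ≤ lam * (v ⬝ᵥ v) := by
  set b := hA.eigenvectorBasis with hb
  let c : (n → ℝ) → n → ℝ := fun x i => inner ℝ (b i) (WithLp.toLp 2 x)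
  have hinner : ∀ x y : n → ℝ, x ⬝ᵥ y = inner ℝ (WithLp.toLp 2 x) (WithLp.toLp 2 y) := by
    intro x y
    simp [EuclideanSpace.inner_eq_star_dotProduct, dotProduct_comm]
  have hsum : ∀ x y : n → ℝ, x ⬝ᵥ y = ∑ i, c x i * c y i := by
    intro x y
    rw [hinner, ← b.sum_inner_mul_inner]
    exact Finset.sum_congr rfl fun i _ => by rw [real_inner_comm]
  have hcA : ∀ x i, c (A *ᵥ x) i = hA.eigenvalues i * c x i := by
    intro x i
    have h1 : ∀ y : n → ℝ, c y i = (b i).ofLp ⬝ᵥ y := fun y => by rw [hinner]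
    rw [h1, h1, dotProduct_mulVec, ← mulVec_transpose]
    have : Aᵀ = A := by simpa [IsHermitian] using hA
    rw [this, hA.mulVec_eigenvectorBasis, smul_dotProduct, smul_eq_mul]
  let e : Fin (Fintype.card n) ≃ n := Fintype.equivOfCardEq (Fintype.card_fin _)
  -- The index of the largest eigenvalue; every other index has position at least 1 in the
  -- decreasing list.
  let i0 : n := e ⟨0, by omega⟩
  have hle : ∀ i, i ≠ i0 → hA.eigenvalues i ≤ lam := by
    intro i hi
    refine le_trans (hA.eigenvalues₀_antitone ?_) hlam
    have : e.symm i ≠ ⟨0, by omega⟩ := fun h' => hi (by rw [← e.apply_symm_apply i, h'])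
    rw [Fin.le_def]
    have h2 : (e.symm i).val ≠ 0 := fun h' => this (Fin.ext h')
    exact Nat.one_le_iff_ne_zero.2 h2
  -- Comparing coordinates of the eigenvector equation gives (μ - λᵢ) cᵢ = 0, and λᵢ ≤ lam < μ off
  -- i0. So u is a multiple of the top basis vector, and v has no component along it.
  have hcu : ∀ i, i ≠ i0 → c u i = 0 := by
    intro i hi
    have h1 := hcA u i
    have h2 : c (A *ᵥ u) i = μ * c u i := by
      rw [hu]; simp only [c, WithLp.toLp_smul, inner_smul_right]
    have h3 := hle i hi
    have : (μ - hA.eigenvalues i) * c u i = 0 := by linarith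
    rcases mul_eq_zero.1 this with h4 | h4
    · linarith
    · exact h4
  have hu1 : c u i0 ≠ 0 := by
    intro h0
    apply hu0
    have : u ⬝ᵥ u = 0 := by
      rw [hsum]
      refine Finset.sum_eq_zero fun i _ => ?_
      by_cases hi : i = i0
      · rw [hi, h0, zero_mul]
      · rw [hcu i hi, zero_mul]
    exact dotProduct_self_eq_zero.1 this
  have hv : c v i0 = 0 := by
    rw [hsum, Finset.sum_eq_single i0 (fun i _ hi => by rw [hcu i hi, zero_mul])
      (fun h => absurd (Finset.mem_univ _) h)] at huv
    exact (mul_eq_zero.1 huv).resolve_left hu1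
  rw [hsum, hsum, Finset.mul_sum]
  refine Finset.sum_le_sum fun i _ => ?_
  rw [hcA]
  by_cases hi : i = i0
  · rw [hi, hv]; simp
  · nlinarith [hle i hi, mul_self_nonneg (c v i)]

open Matrix in
theorem BipartiteGraph.IsBiregular.sum_row {G : BipartiteGraph} {DL DR : ℕ}
    (hreg : G.IsBiregular DL DR) (i : G.L) : ∑ j, G.biadjacency i j = DL := by
  rw [← hreg.1 i i.2, ← Finset.sum_boole]
  simp only [biadjacency, of_apply]
  exact Finset.sum_coe_sort G.R (fun j => if ((i : List Bool), j) ∈ G.E then (1 : ℝ) else 0)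

open Matrix in
theorem BipartiteGraph.IsBiregular.sum_col {G : BipartiteGraph} {DL DR : ℕ}
    (hreg : G.IsBiregular DL DR) (j : G.R) : ∑ i, G.biadjacency i j = DR := by
  rw [← hreg.2 j j.2, ← Finset.sum_boole]
  simp only [biadjacency, of_apply]
  exact Finset.sum_coe_sort G.L (fun i => if (i, (j : List Bool)) ∈ G.E then (1 : ℝ) else 0)

open Matrix in
/-- Bilinear form bound for a bipartite graph with large degrees. -/
theorem BipartiteGraph.dotProduct_biadjacency_mulVec_le {G : BipartiteGraph} {DL DR : ℕ} {lam : ℝ}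
    (hreg : G.IsBiregular DL DR) (hL : G.L.Nonempty)
    (h : 1 < Fintype.card (G.L ⊕ G.R))
    (hlam : G.adjacency_isHermitian.eigenvalues₀ ⟨1, h⟩ ≤ lam)
    (hlt : lam < Real.sqrt (DL * DR)) (hDL : 0 < DL)
    {f : G.L → ℝ} {g : G.R → ℝ} (hf : ∑ i, f i = 0) (hg : ∑ j, g j = 0) :
    2 * (f ⬝ᵥ (G.biadjacency *ᵥ g)) ≤ lam * (f ⬝ᵥ f + g ⬝ᵥ g) := by
  have hrow := hreg.sum_row
  have hcol := hreg.sum_col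
  -- The Perron vector: on the left DL·√DR = √(DL·DR)·√DL, and symmetrically on the right. It is
  -- constant on each side, so vectors with zero sum on both sides are orthogonal to it.
  let u : G.L ⊕ G.R → ℝ := Sum.elim (fun _ => Real.sqrt DL) (fun _ => Real.sqrt DR)
  have hu0 : u ≠ 0 := by
    obtain ⟨x, hx⟩ := hL
    intro h0
    have := congrFun h0 (Sum.inl ⟨x, hx⟩)
    have h2 : (0 : ℝ) < Real.sqrt DL := Real.sqrt_pos.2 (by exact_mod_cast hDL)
    simp only [u, Sum.elim_inl, Pi.zero_apply] at this
    linarith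
  have hu : G.adjacency *ᵥ u = Real.sqrt (DL * DR) • u := by
    have e1 : Real.sqrt DL * Real.sqrt DL = DL := Real.mul_self_sqrt (Nat.cast_nonneg _)
    have e2 : Real.sqrt DR * Real.sqrt DR = DR := Real.mul_self_sqrt (Nat.cast_nonneg _)
    rw [adjacency, fromBlocks_mulVec, Real.sqrt_mul (Nat.cast_nonneg _)]
    ext i
    rcases i with i | j
    · simp only [u, Sum.elim_inl, Pi.smul_apply, smul_eq_mul, zero_mulVec, zero_add,
        Sum.elim_comp_inr, mulVec, dotProduct]
      rw [← Finset.sum_mul, hrow]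
      linear_combination (-Real.sqrt DR) * e1
    · simp only [u, Sum.elim_inr, Pi.smul_apply, smul_eq_mul, zero_mulVec, add_zero,
        Sum.elim_comp_inl, mulVec, dotProduct, transpose_apply]
      rw [← Finset.sum_mul, hcol]
      linear_combination (-Real.sqrt DL) * e2
  have key := dotProduct_mulVec_le_of_orthogonal (v := Sum.elim f g) G.adjacency_isHermitian h hu0
    hu hlam hlt (by
      simp only [dotProduct, Fintype.sum_sum_type, u, Sum.elim_inl, Sum.elim_inr]
      rw [← Finset.mul_sum, ← Finset.mul_sum, hf, hg]; simp)
  rw [adjacency, fromBlocks_mulVec, Sum.elim_comp_inl, Sum.elim_comp_inr, zero_mulVec, zero_mulVec,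
    zero_add, add_zero, sumElim_dotProduct_sumElim, sumElim_dotProduct_sumElim,
    mulVec_transpose, dotProduct_comm g, ← dotProduct_mulVec] at key
  linarith

/-- The expander mixing lemma (upper bound) for a biregular bipartite graph. -/
theorem BipartiteGraph.mixing {G : BipartiteGraph} {DL DR : ℕ} {lam : ℝ}
    (hreg : G.IsBiregular DL DR) (h : 1 < Fintype.card (G.L ⊕ G.R))
    (hlam : G.adjacency_isHermitian.eigenvalues₀ ⟨1, h⟩ ≤ lam)
    (hlt : lam < Real.sqrt (DL * DR)) (hDL : 0 < DL) (hlam0 : 0 ≤ lam)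
    {A B : Finset (List Bool)} (hA : A ⊆ G.L) (hB : B ⊆ G.R) :
    ((G.E.filter fun e => e.1 ∈ A ∧ e.2 ∈ B).card : ℝ) ≤
      DL * A.card * B.card / G.R.card + lam * Real.sqrt (A.card * B.card) := by
  rcases A.eq_empty_or_nonempty with rfl | hA0
  · simp
  rcases B.eq_empty_or_nonempty with rfl | hB0
  · simp
  have hrow := hreg.sum_row
  have hcol := hreg.sum_col
  have hL0 : G.L.Nonempty := hA0.mono hA
  have hR0 : G.R.Nonempty := hB0.mono hB
  let a : G.L → ℝ := fun i => if (i : List Bool) ∈ A then 1 else 0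
  let b : G.R → ℝ := fun j => if (j : List Bool) ∈ B then 1 else 0
  have sa : ∑ i, a i = A.card := by
    rw [Finset.sum_coe_sort G.L (fun i => if i ∈ A then (1 : ℝ) else 0), Finset.sum_boole,
      Finset.filter_mem_eq_inter, Finset.inter_eq_right.2 hA]
  have sb : ∑ j, b j = B.card := by
    rw [Finset.sum_coe_sort G.R (fun i => if i ∈ B then (1 : ℝ) else 0), Finset.sum_boole,
      Finset.filter_mem_eq_inter, Finset.inter_eq_right.2 hB]
  have sa2 : ∑ i, a i * a i = A.card := by
    rw [← sa]; exact Finset.sum_congr rfl fun i _ => by simp [a]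
  have sb2 : ∑ j, b j * b j = B.card := by
    rw [← sb]; exact Finset.sum_congr rfl fun i _ => by simp [b]
  have sE : ∑ i, ∑ j, a i * (G.biadjacency i j * b j) =
      ((G.E.filter fun e => e.1 ∈ A ∧ e.2 ∈ B).card : ℝ) := by
    have e1 : ∀ i j, a i * (G.biadjacency i j * b j) =
        if (((i : List Bool), (j : List Bool)) ∈ G.E ∧ (i : List Bool) ∈ A ∧ (j : List Bool) ∈ B)
        then (1 : ℝ) else 0 := by
      intro i j
      simp only [a, b, biadjacency, Matrix.of_apply]
      split_ifs <;> simp_all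
    simp only [e1]
    rw [Finset.sum_coe_sort G.L (fun i => ∑ j : G.R,
      if ((i, (j : List Bool)) ∈ G.E ∧ i ∈ A ∧ (j : List Bool) ∈ B) then (1 : ℝ) else 0)]
    have e2 : ∀ i ∈ G.L, (∑ j : G.R,
        if ((i, (j : List Bool)) ∈ G.E ∧ i ∈ A ∧ (j : List Bool) ∈ B) then (1 : ℝ) else 0) =
        ∑ j ∈ G.R, if ((i, j) ∈ G.E ∧ i ∈ A ∧ j ∈ B) then (1 : ℝ) else 0 := fun i _ =>
      Finset.sum_coe_sort G.R
        (fun j => if ((i, j) ∈ G.E ∧ i ∈ A ∧ j ∈ B) then (1 : ℝ) else 0)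
    rw [Finset.sum_congr rfl e2, ← Finset.sum_product' (f := fun i j =>
      if ((i, j) ∈ G.E ∧ i ∈ A ∧ j ∈ B) then (1 : ℝ) else 0), Finset.sum_boole]
    congr 2
    ext e
    simp only [Finset.mem_filter]
    exact ⟨fun h => h.2, fun h => ⟨G.E_subset h.1, h⟩⟩
  have hl : (0 : ℝ) < G.L.card := by exact_mod_cast hL0.card_pos
  have hr : (0 : ℝ) < G.R.card := by exact_mod_cast hR0.card_pos
  have hcA : (0 : ℝ) < A.card := by exact_mod_cast hA0.card_pos
  have hcB : (0 : ℝ) < B.card := by exact_mod_cast hB0.card_pos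
  have sR : ∑ i, ∑ j, a i * G.biadjacency i j = DL * A.card := by
    simp only [← Finset.mul_sum, hrow]
    rw [← Finset.sum_mul, sa, mul_comm]
  have sL : ∑ i, ∑ j, G.biadjacency i j * b j = DR * B.card := by
    rw [Finset.sum_comm]
    simp only [← Finset.sum_mul, hcol]
    rw [← Finset.mul_sum, sb]
  have s1 : ∑ i, ∑ j, G.biadjacency i j = DL * G.L.card := by
    simp only [hrow]
    simp [mul_comm]
  have s2 : ∑ i, ∑ j, G.biadjacency i j = DR * G.R.card := by
    refine Finset.sum_comm.trans ?_
    simp only [hcol]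
    simp [mul_comm]
  set p : ℝ := A.card / G.L.card with hp
  set r : ℝ := B.card / G.R.card with hrr
  have hpl : p * G.L.card = A.card := by rw [hp]; field_simp
  have hrl : r * G.R.card = B.card := by rw [hrr]; field_simp
  -- The weights √|B| on the left and √|A| on the right bound both squared norms by |A||B|. The
  -- arithmetic mean in the bilinear bound then already yields the factor √(|A||B|).
  set α := Real.sqrt B.card with hα
  set β := Real.sqrt A.card with hβ
  have hαα : α * α = B.card := Real.mul_self_sqrt hcB.le
  have hββ : β * β = A.card := Real.mul_self_sqrt hcA.le
  have hα0 : 0 < α := Real.sqrt_pos.2 hcB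
  have hβ0 : 0 < β := Real.sqrt_pos.2 hcA
  have cl : (∑ _i : G.L, (1 : ℝ)) = G.L.card := by simp
  have cr : (∑ _i : G.R, (1 : ℝ)) = G.R.card := by simp
  have key := dotProduct_biadjacency_mulVec_le hreg hL0 h hlam hlt hDL
    (f := fun i => α * (a i - p * 1)) (g := fun j => β * (b j - r * 1))
    (by rw [← Finset.mul_sum, Finset.sum_sub_distrib, ← Finset.mul_sum, sa, cl, hpl]; ring)
    (by rw [← Finset.mul_sum, Finset.sum_sub_distrib, ← Finset.mul_sum, sb, cr, hrl]; ring)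
  have hbil : (fun i => α * (a i - p * 1)) ⬝ᵥ (Matrix.mulVec G.biadjacency
      (fun j => β * (b j - r * 1))) = α * β * ((G.E.filter fun e => e.1 ∈ A ∧ e.2 ∈ B).card
        - p * (DR * B.card) - r * (DL * A.card) + p * r * (DL * G.L.card)) := by
    rw [← sE, ← sR, ← sL, ← s1]
    simp only [dotProduct, Matrix.mulVec, Finset.mul_sum, ← Finset.sum_sub_distrib,
      ← Finset.sum_add_distrib]
    exact Finset.sum_congr rfl fun i _ => Finset.sum_congr rfl fun j _ => by ring
  have hff : (fun i => α * (a i - p * 1)) ⬝ᵥ (fun i => α * (a i - p * 1)) ≤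
      B.card * A.card := by
    have : (fun i => α * (a i - p * 1)) ⬝ᵥ (fun i => α * (a i - p * 1)) =
        α * α * (∑ i, a i * a i - 2 * p * ∑ i, a i + p * p * ∑ _i : G.L, (1 : ℝ)) := by
      simp only [dotProduct, Finset.mul_sum, ← Finset.sum_sub_distrib, ← Finset.sum_add_distrib]
      exact Finset.sum_congr rfl fun i _ => by ring
    rw [this, hαα, sa2, sa, cl, mul_assoc p p, hpl]
    have : 0 ≤ p * A.card := by positivity
    exact mul_le_mul_of_nonneg_left (by linarith) hcB.le
  have hgg : (fun i => β * (b i - r * 1)) ⬝ᵥ (fun i => β * (b i - r * 1)) ≤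
      B.card * A.card := by
    have : (fun i => β * (b i - r * 1)) ⬝ᵥ (fun i => β * (b i - r * 1)) =
        β * β * (∑ i, b i * b i - 2 * r * ∑ i, b i + r * r * ∑ _i : G.R, (1 : ℝ)) := by
      simp only [dotProduct, Finset.mul_sum, ← Finset.sum_sub_distrib, ← Finset.sum_add_distrib]
      exact Finset.sum_congr rfl fun i _ => by ring
    rw [this, hββ, sb2, sb, cr, mul_assoc r r, hrl, mul_comm (B.card : ℝ)]
    have : 0 ≤ r * B.card := by positivity
    exact mul_le_mul_of_nonneg_left (by linarith) hcA.le
  rw [hbil] at key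
  have hs : Real.sqrt (A.card * B.card) = α * β := by
    rw [Real.sqrt_mul hcA.le, mul_comm]
  have hαβ : (B.card : ℝ) * A.card = (α * β) * (α * β) := by rw [← hαα, ← hββ]; ring
  -- Counting all edges from either side makes two of the four terms of the centred form cancel,
  -- leaving the deviation from the expected edge count.
  have hpr : p * (DR * B.card) = p * r * (DL * G.L.card) := by
    rw [← hrl, ← s1, s2]; ring
  have hfin : DL * A.card * B.card / G.R.card = r * (DL * A.card) := by
    rw [hrr]; ring
  rw [hs, hfin]
  have h2 : 2 * (α * β * ((G.E.filter fun e => e.1 ∈ A ∧ e.2 ∈ B).card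
        - p * (DR * B.card) - r * (DL * A.card) + p * r * (DL * G.L.card))) ≤
        lam * (2 * ((α * β) * (α * β))) := by
    refine key.trans (mul_le_mul_of_nonneg_left ?_ hlam0)
    rw [← hαβ]; linarith
  have h3 := mul_pos hα0 hβ0
  have h4 : (α * β) * ((G.E.filter fun e => e.1 ∈ A ∧ e.2 ∈ B).card - r * (DL * A.card)) ≤
      (α * β) * (lam * (α * β)) := by
    rw [hpr] at h2; linarith
  have h5 := le_of_mul_le_mul_left h4 h3
  linarith

end KolmogorovMixing

/-! ### Describing strings by their index in an enumeration -/

namespace KolmogorovMixing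

open Encodable

/-- The natural number with a given list of binary digits, least significant digit first. -/
def binVal (l : List Bool) : ℕ := l.foldr Nat.bit 0

theorem binVal_bits (n : ℕ) : binVal n.bits = n := by
  induction n using Nat.binaryRec' with
  | zero => simp [binVal]
  | bit b n h ih =>
    rw [Nat.bits_append_bit _ _ h]
    simp only [binVal, List.foldr_cons] at ih ⊢
    rw [ih]

theorem exists_binVal_eq {n m : ℕ} (h : n < 2 ^ m) : ∃ l, binVal l = n ∧ l.length ≤ m :=
  ⟨n.bits, binVal_bits n, by rw [Nat.size_eq_bits_len]; exact Nat.size_le.2 h⟩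

theorem primrec_binVal : Primrec binVal := by
  refine Primrec.list_foldr (f := id) (g := fun _ => 0) (h := fun _ p => Nat.bit p.1 p.2)
    Primrec.id (Primrec.const 0) ?_
  have hb : Primrec fun p : List Bool × Bool × ℕ => p.2.1 := Primrec.fst.comp Primrec.snd
  have hn : Primrec fun p : List Bool × Bool × ℕ => p.2.2 := Primrec.snd.comp Primrec.snd
  exact (Primrec.cond hb (Primrec.nat_double_succ.comp hn) (Primrec.nat_double.comp hn)).of_eq
    fun p => by cases h : p.2.1 <;> simp [Nat.bit, h]

theorem length_pairCode (x y : List Bool) :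
    (pairCode x y).length = 2 * x.length + 2 + y.length := by
  simp [pairCode, List.length_flatMap]
  omega

theorem pairCode_injective {x y x' y' : List Bool} (h : pairCode x y = pairCode x' y') :
    x = x' ∧ y = y' := by
  induction x generalizing x' with
  | nil =>
    cases x' with
    | nil => simpa [pairCode] using h
    | cons b l => cases b <;> simp [pairCode] at h
  | cons a l ih =>
    cases x' with
    | nil => cases a <;> simp [pairCode] at h
    | cons b l' =>
      have h1 : a = b ∧ pairCode l y = pairCode l' y' := by
        simp only [pairCode, List.flatMap_cons, List.cons_append,
          List.nil_append, List.cons.injEq] at h ⊢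
        exact ⟨h.1, h.2.2⟩
      obtain ⟨h2, h3⟩ := ih h1.2
      exact ⟨by rw [h1.1, h2], h3⟩

theorem primrec_pairCode : Primrec₂ pairCode := by
  refine Primrec.list_append.comp (Primrec.list_flatMap Primrec.fst ?_)
    (Primrec.list_cons.comp (Primrec.const false) (Primrec.list_cons.comp (Primrec.const true)
      Primrec.snd))
  exact Primrec.list_cons.comp Primrec.snd (Primrec.list_cons.comp Primrec.snd (Primrec.const []))

theorem primrecRel_list_mem {β : Type*} [Primcodable β] :
    PrimrecRel fun (l : List β) (b : β) => b ∈ l :=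
  (PrimrecRel.exists_mem_list (R := fun a b : β => a = b) Primrec.eq).of_eq
    fun l b => by simp

/-- The list, without repetitions, of the first outputs of an enumeration. -/
def enumList {β : Type*} [DecidableEq β] (F : ℕ → Option β) : ℕ → List β
  | 0 => []
  | n + 1 => (F n).elim (enumList F n) fun x =>
      if x ∈ enumList F n then enumList F n else enumList F n ++ [x]

section enumList

variable {β : Type*} [DecidableEq β] (F : ℕ → Option β)

theorem enumList_prefix_succ (n : ℕ) : enumList F n <+: enumList F (n + 1) := by
  rw [enumList]
  cases F n with
  | none => exact List.prefix_rfl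
  | some x =>
    simp only [Option.elim_some]
    split_ifs
    · exact List.prefix_rfl
    · exact List.prefix_append _ _

/-- Since the list only grows at its end, an index keeps naming the same string however long the
enumeration runs. -/
theorem enumList_prefix {n m : ℕ} (h : n ≤ m) : enumList F n <+: enumList F m := by
  induction m, h using Nat.le_induction with
  | base => exact List.prefix_rfl
  | succ m _ ih => exact ih.trans (enumList_prefix_succ F m)

theorem nodup_enumList (n : ℕ) : (enumList F n).Nodup := by
  induction n with
  | zero => exact List.nodup_nil
  | succ n ih =>
    rw [enumList]
    cases F n with
    | none => exact ih
    | some x =>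
      simp only [Option.elim_some]
      split_ifs with h
      · exact ih
      · exact List.nodup_append.2 ⟨ih, List.nodup_singleton x, by
          intro a ha b hb hab
          rw [List.mem_singleton] at hb
          exact h (by rw [← hb, ← hab]; exact ha)⟩

theorem mem_enumList {n : ℕ} {x : β} : x ∈ enumList F n ↔ ∃ k < n, F k = some x := by
  induction n with
  | zero => simp [enumList]
  | succ n ih =>
    have h1 : (∃ k < n + 1, F k = some x) ↔ (∃ k < n, F k = some x) ∨ F n = some x := by
      constructor
      · rintro ⟨k, hk, h⟩
        rcases Nat.lt_succ_iff_lt_or_eq.1 hk with hk | rfl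
        · exact Or.inl ⟨k, hk, h⟩
        · exact Or.inr h
      · rintro (⟨k, hk, h⟩ | h)
        · exact ⟨k, by omega, h⟩
        · exact ⟨n, by omega, h⟩
    rw [h1, ← ih, enumList]
    cases hF : F n with
    | none => simp
    | some y =>
      simp only [Option.elim_some, Option.some.injEq]
      split_ifs with hy
      · constructor
        · exact Or.inl
        · rintro (h | rfl) <;> assumption
      · rw [List.mem_append, List.mem_singleton, eq_comm]

end enumList

theorem computable_enumList {γ β : Type*} [Primcodable γ] [Primcodable β] [DecidableEq β]
    {F : γ → ℕ → Option β} (hF : Computable₂ F) :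
    Computable₂ fun (c : γ) (n : ℕ) => enumList (F c) n := by
  have hstep : Computable₂ fun (q : γ × ℕ) (p : ℕ × List β) =>
      (Option.casesOn (F q.1 p.1) p.2 fun x => bif decide (x ∈ p.2) then p.2 else p.2 ++ [x] :
        List β) := by
    refine Computable.option_casesOn (hF.comp (Computable.fst.comp Computable.fst)
      (Computable.fst.comp Computable.snd)) (Computable.snd.comp Computable.snd) ?_
    have hl : Computable fun q : ((γ × ℕ) × ℕ × List β) × β => q.1.2.2 :=
      Computable.snd.comp (Computable.snd.comp Computable.fst)
    refine Computable.cond ?_ hl (Computable.list_concat.comp hl Computable.snd)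
    exact (primrecRel_list_mem (β := β)).decide.to_comp.comp hl Computable.snd
  refine (Computable.nat_rec Computable.snd (Computable.const []) hstep).of_eq ?_
  rintro ⟨c, n⟩
  induction n with
  | zero => rfl
  | succ n ih =>
    dsimp only at ih ⊢
    rw [enumList.eq_2, ← ih]
    cases F c n with
    | none => rfl
    | some x => simp only [Option.elim_some, Bool.cond_decide]

/-- The decompressor whose programs consist of a parameter and of an index in an enumeration. -/
def indexDecompressor {α : Type*} [Primcodable α] (F : α × List Bool → ℕ → Option (List Bool)) :
    Decompressor := fun p y =>
  Nat.rfindOpt fun n => (decode n : Option (ℕ × List Bool × List Bool)).bind fun z =>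
    bif decide (pairCode z.2.1 z.2.2 = p) then
      (decode (binVal z.2.1) : Option α).bind fun a => (enumList (F (a, y)) z.1)[binVal z.2.2]?
    else none

theorem partrec_indexDecompressor {α : Type*} [Primcodable α]
    {F : α × List Bool → ℕ → Option (List Bool)} (hF : Computable₂ F) :
    Partrec₂ (indexDecompressor F) := by
  refine Partrec.rfindOpt (Computable.option_bind (Computable.decode.comp Computable.snd) ?_)
  have hz : Computable fun q : ((List Bool × List Bool) × ℕ) × ℕ × List Bool × List Bool => q.2 :=
    Computable.snd
  have hu := Computable.fst.comp (Computable.snd.comp hz)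
  have hv := Computable.snd.comp (Computable.snd.comp hz)
  have hp : Computable fun q : ((List Bool × List Bool) × ℕ) × ℕ × List Bool × List Bool =>
    q.1.1.1 := Computable.fst.comp (Computable.fst.comp Computable.fst)
  refine Computable.cond ?_ (Computable.option_bind
    (Computable.decode.comp (primrec_binVal.to_comp.comp hu)) ?_) (Computable.const none)
  · exact (Primrec.eq (α := List Bool)).decide.to_comp.comp
      (primrec_pairCode.to_comp.comp hu hv) hp
  · refine Computable.list_getElem?.comp ((computable_enumList hF).comp
      (Computable.snd.pair ?_) (Computable.fst.comp (hz.comp Computable.fst)))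
      (primrec_binVal.to_comp.comp (hv.comp Computable.fst))
    exact Computable.snd.comp (Computable.fst.comp (Computable.fst.comp Computable.fst))

/-- The program is the code of the parameter with doubled bits, a separator of two bits, and the
index of x in binary. The index is below |S| ≤ 2^m because the enumeration has no repetitions and
stays inside S. -/
theorem exists_program_indexDecompressor {α : Type*} [Primcodable α]
    {F : α × List Bool → ℕ → Option (List Bool)} {a : α} {y x : List Bool} {m : ℕ}
    {S : Finset (List Bool)} (hS : ∀ n x, F (a, y) n = some x → x ∈ S) (hm : S.card ≤ 2 ^ m)
    (hx : ∃ n, F (a, y) n = some x) :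
    ∃ p, x ∈ indexDecompressor F p y ∧ p.length ≤ 2 * (encode a).size + 2 + m := by
  obtain ⟨k, hk⟩ := hx
  have hmem : x ∈ enumList (F (a, y)) (k + 1) := (mem_enumList _).2 ⟨k, k.lt_succ_self, hk⟩
  obtain ⟨i, hi, hxi⟩ := List.mem_iff_getElem.1 hmem
  have hlen : (enumList (F (a, y)) (k + 1)).length ≤ S.card := by
    rw [← List.toFinset_card_of_nodup (nodup_enumList _ _)]
    refine Finset.card_le_card fun z hz => ?_
    obtain ⟨n, -, hn⟩ := (mem_enumList _).1 (List.mem_toFinset.1 hz)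
    exact hS n z hn
  obtain ⟨v, hv, hvl⟩ := exists_binVal_eq (n := i) (m := m) (by omega)
  obtain ⟨u, hu, hul⟩ := exists_binVal_eq (Nat.lt_size_self (encode a))
  refine ⟨pairCode u v, ?_, by rw [length_pairCode]; omega⟩
  have hdom : (indexDecompressor F (pairCode u v) y).Dom := by
    refine Nat.rfindOpt_dom.2 ⟨encode (k + 1, u, v), x, ?_⟩
    simp [hu, hv, List.getElem?_eq_getElem hi, hxi]
  obtain ⟨z, hz⟩ := Part.dom_iff_mem.1 hdom
  obtain ⟨n, hn⟩ := Nat.rfindOpt_spec hz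
  -- The search may halt at another triple. Injectivity of the pair code forces the same parameter
  -- and index, and only the number of steps can differ, which does not change the entry.
  suffices z = x by rwa [← this]
  rw [Option.mem_def, Option.bind_eq_some_iff] at hn
  obtain ⟨⟨s, u', v'⟩, -, hn⟩ := hn
  by_cases hpc : pairCode u' v' = pairCode u v
  · obtain ⟨rfl, rfl⟩ := pairCode_injective hpc
    simp only [decide_true, cond_true, hu, hv, encodek, Option.bind_some] at hn
    obtain ⟨his, hzi⟩ := List.getElem?_eq_some_iff.1 hn
    rw [← hzi, ← hxi]
    rcases le_total s (k + 1) with h | h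
    · exact (enumList_prefix _ h).getElem his
    · exact ((enumList_prefix _ h).getElem hi).symm
  · simp [hpc] at hn

theorem condC_le_length {U : Decompressor} {p x y : List Bool} (h : x ∈ U p y) :
    condC U x y ≤ p.length :=
  Nat.sInf_le ⟨p, h, rfl⟩

/-- Strings from a set that is enumerable with the help of a parameter and a condition have
complexity at most the logarithm of the size of the set plus the length of the parameter. -/
theorem IsOptimal.condC_le_of_enumerable {U : Decompressor} (hU : IsOptimal U)
    {σ α : Type*} [Primcodable σ] [Primcodable α] {P : σ → List Bool → α → List Bool → Prop}
    (hP : ComputablePred fun z : σ × List Bool × α × List Bool => P z.1 z.2.1 z.2.2.1 z.2.2.2) :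
    ∃ c : ℕ, ∀ (a : α) (x y : List Bool) (m : ℕ) (S : Finset (List Bool)),
      (∀ s z, P s z a y → z ∈ S) → S.card ≤ 2 ^ m → (∃ s, P s x a y) →
      condC U x y ≤ m + 2 * (encode a).size + c := by
  classical
  -- Dovetailing: run through all pairs of a witness and a string, and output the string when the
  -- decidable relation holds.
  let F : α × List Bool → ℕ → Option (List Bool) := fun q n =>
    (decode n : Option (σ × List Bool)).bind fun z =>
      bif decide (P z.1 z.2 q.1 q.2) then some z.2 else none
  have hF : Computable₂ F := by
    refine Computable.option_bind (Computable.decode.comp Computable.snd) ?_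
    have hz : Computable fun q : ((α × List Bool) × ℕ) × σ × List Bool => q.2 := Computable.snd
    have hq : Computable fun q : ((α × List Bool) × ℕ) × σ × List Bool => q.1.1 :=
      Computable.fst.comp Computable.fst
    have hd := hP.decide.comp (g := fun q : ((α × List Bool) × ℕ) × σ × List Bool =>
      (q.2.1, q.2.2, q.1.1)) ((Computable.fst.comp hz).pair ((Computable.snd.comp hz).pair hq))
    exact Computable.cond hd (Computable.option_some.comp (Computable.snd.comp hz))
      (Computable.const none)
  obtain ⟨c, hc⟩ := hU.2 (indexDecompressor F) (partrec_indexDecompressor hF)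
  refine ⟨c + 2, fun a x y m S hS hm hx => ?_⟩
  obtain ⟨p, hp, hpl⟩ := exists_program_indexDecompressor (F := F) (a := a) (y := y) (x := x)
    (m := m) (S := S) (fun n z hn => by
      obtain ⟨⟨s, z'⟩, -, h⟩ := Option.bind_eq_some_iff.1 hn
      by_cases h' : P s z' a y
      · simp only [h', decide_true, cond_true, Option.some.injEq] at h
        exact h ▸ hS s z' h'
      · simp [h'] at h) hm (by
      obtain ⟨s, hs⟩ := hx
      exact ⟨encode (s, x), by simp [F, hs]⟩)
  obtain ⟨p', hp', hl⟩ := hc p y x hp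
  have := condC_le_length hp'
  omega

/-- Every string is an output of an optimal decompressor, with a program not much longer than the
string itself. -/
theorem IsOptimal.exists_program {U : Decompressor} (hU : IsOptimal U) :
    ∃ c : ℕ, ∀ x y : List Bool, ∃ p, x ∈ U p y ∧ p.length ≤ x.length + c := by
  obtain ⟨c, hc⟩ := hU.2 (fun p _ => Part.some p) (Computable.fst.partrec)
  exact ⟨c, fun x y => hc x y x (Part.mem_some x)⟩

/-- The set of program lengths is nonempty, so `sInf` is attained and is not the default value 0. -/
theorem IsOptimal.exists_shortest_program {U : Decompressor} (hU : IsOptimal U)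
    (x y : List Bool) : ∃ p, x ∈ U p y ∧ p.length = condC U x y := by
  obtain ⟨c, hc⟩ := hU.exists_program
  obtain ⟨p, hp, -⟩ := hc x y
  exact Nat.sInf_mem (s := {l : ℕ | ∃ p : List Bool, x ∈ U p y ∧ p.length = l}) ⟨_, p, hp, rfl⟩

theorem IsOptimal.exists_condC_le_length {U : Decompressor} (hU : IsOptimal U) :
    ∃ c : ℕ, ∀ x y : List Bool, condC U x y ≤ x.length + c := by
  obtain ⟨c, hc⟩ := hU.exists_program
  refine ⟨c, fun x y => ?_⟩
  obtain ⟨p, hp, hl⟩ := hc x y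
  exact (condC_le_length hp).trans hl

end KolmogorovMixing

/-! ### Stages of the enumeration of simple strings, and the easy chain rule -/

namespace KolmogorovMixing

open Encodable Nat.Partrec

/-- All bit strings of length at most `n`. -/
def shortStrings : ℕ → Finset (List Bool)
  | 0 => {[]}
  | n + 1 => insert [] ((shortStrings n).image (List.cons true) ∪
      (shortStrings n).image (List.cons false))

theorem mem_shortStrings {n : ℕ} {p : List Bool} (h : p.length ≤ n) : p ∈ shortStrings n := by
  induction n generalizing p with
  | zero => simp [shortStrings, List.length_eq_zero_iff.1 (Nat.le_zero.1 h)]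
  | succ n ih =>
    cases p with
    | nil => simp [shortStrings]
    | cons b l =>
      have := ih (p := l) (by simpa using h)
      cases b <;> simp [shortStrings, this]

theorem card_shortStrings_lt (n : ℕ) : (shortStrings n).card < 2 ^ (n + 1) := by
  induction n with
  | zero => simp [shortStrings]
  | succ n ih =>
    have h1 := Finset.card_insert_le ([] : List Bool) ((shortStrings n).image (List.cons true) ∪
      (shortStrings n).image (List.cons false))
    have h2 := Finset.card_union_le ((shortStrings n).image (List.cons true))
      ((shortStrings n).image (List.cons false))
    have h3 := Finset.card_image_le (s := shortStrings n) (f := List.cons true)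
    have h4 := Finset.card_image_le (s := shortStrings n) (f := List.cons false)
    rw [shortStrings, pow_succ]
    omega

/-- There are less than `2 ^ (a + 1)` outputs of programs of length at most `a`. -/
theorem exists_finset_outputs (U : Decompressor) (a : ℕ) (y : List Bool) :
    ∃ S : Finset (List Bool), (∀ x p, x ∈ U p y → p.length ≤ a → x ∈ S) ∧
      S.card ≤ 2 ^ (a + 1) := by
  classical
  refine ⟨(shortStrings a).image fun p => if h : (U p y).Dom then (U p y).get h else [], ?_,
    Finset.card_image_le.trans (card_shortStrings_lt a).le⟩
  intro x p hx hp
  obtain ⟨h, hx⟩ := hx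
  exact Finset.mem_image.2 ⟨p, mem_shortStrings hp, by rw [dif_pos h, hx]⟩

theorem primrec_evaln_comp (c : Code) {γ : Type*} [Primcodable γ] {f g : γ → ℕ} (hf : Primrec f)
    (hg : Primrec g) : Primrec fun q => Code.evaln (f q) c (g q) :=
  Code.primrec_evaln.comp ((hf.pair (Primrec.const c)).pair hg)

theorem primrec_evaln_encode_pair (c : Code) {γ β β' : Type*} [Primcodable γ] [Primcodable β]
    [Primcodable β'] {f : γ → ℕ} {g : γ → β} {h : γ → β'} (hf : Primrec f) (hg : Primrec g)
    (hh : Primrec h) : Primrec fun q => Code.evaln (f q) c (encode (g q, h q)) :=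
  primrec_evaln_comp c hf (Primrec.encode.comp (hg.pair hh))

/-- The relation "`x` has a program of length at most `a` with condition `y`" is the monotone
limit of primitive recursive relations. -/
theorem exists_stages {U : Decompressor} (hU : Partrec₂ U) :
    ∃ A : ℕ → ℕ → List Bool → List Bool → Bool,
      (Primrec fun z : ℕ × ℕ × List Bool × List Bool => A z.1 z.2.1 z.2.2.1 z.2.2.2) ∧
      (∀ {s s' a y x}, s ≤ s' → A s a y x = true → A s' a y x = true) ∧
      ∀ a y x, (∃ s, A s a y x = true) ↔ ∃ p, x ∈ U p y ∧ p.length ≤ a := by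
  obtain ⟨c, hc⟩ := Code.exists_code.1 hU
  have heval : ∀ p y x, encode x ∈ Code.eval c (encode (p, y)) ↔ x ∈ U p y := by
    intro p y x
    rw [hc]
    simp
  let T : ℕ → ℕ × ℕ × List Bool × List Bool → Prop := fun n z =>
    ((decode n : Option (List Bool)).map fun p => decide (p.length ≤ z.2.1) &&
      decide (Code.evaln z.1 c (encode (p, z.2.2.1)) = some (encode z.2.2.2))) = some true
  have hT : PrimrecRel T := by
    refine Primrec.eq.comp (Primrec.option_map (Primrec.decode.comp Primrec.fst) ?_)
      (Primrec.const _)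
    have hp : Primrec fun q : (ℕ × ℕ × ℕ × List Bool × List Bool) × List Bool => q.2 :=
      Primrec.snd
    have hz : Primrec fun q : (ℕ × ℕ × ℕ × List Bool × List Bool) × List Bool => q.1.2 :=
      Primrec.snd.comp Primrec.fst
    have hz2 := Primrec.snd.comp hz
    have hz3 := Primrec.snd.comp hz2
    have h1 : Primrec fun q : (ℕ × ℕ × ℕ × List Bool × List Bool) × List Bool =>
        decide (q.2.length ≤ q.1.2.2.1) :=
      Primrec.nat_le.decide.comp (Primrec.list_length.comp hp) (Primrec.fst.comp hz2)
    have h2 := primrec_evaln_encode_pair c (Primrec.fst.comp hz) hp (Primrec.fst.comp hz3)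
    have h3 : Primrec fun q : (ℕ × ℕ × ℕ × List Bool × List Bool) × List Bool =>
        some (encode q.1.2.2.2.2) :=
      Primrec.option_some.comp (Primrec.encode.comp (Primrec.snd.comp hz3))
    have h4 : Primrec fun q : (ℕ × ℕ × ℕ × List Bool × List Bool) × List Bool =>
        decide (Code.evaln q.1.2.1 c (encode (q.2, q.1.2.2.2.1)) = some (encode q.1.2.2.2.2)) :=
      (Primrec.eq (α := Option ℕ)).decide.comp h2 h3
    exact Primrec.and.comp h1 h4
  have hTd : ∀ {n z}, T n z ↔ ∃ p : List Bool, decode n = some p ∧ p.length ≤ z.2.1 ∧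
      encode z.2.2.2 ∈ Code.evaln z.1 c (encode (p, z.2.2.1)) := by
    intro n z
    simp only [T, Option.map_eq_some_iff, Bool.and_eq_true]
    exact exists_congr fun p => and_congr_right' (and_congr decide_eq_true_iff decide_eq_true_iff)
  have hE : PrimrecPred fun z : ℕ × ℕ × List Bool × List Bool => ∃ n < z.1, T n z :=
    ((PrimrecRel.exists_mem_list hT).comp (Primrec.list_range.comp Primrec.fst)
      Primrec.id).of_eq fun z => by simp
  obtain ⟨hdec, hprim⟩ := hE
  -- The stage s bounds both the codes of the programs tried and the evaluation fuel, so a stage is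
  -- decidable and grows with s.
  refine ⟨fun s a y x => decide (∃ n < s, T n (s, a, y, x)),
    hprim.of_eq fun z => by simp, ?_, ?_⟩
  · intro s s' a y x hs h
    simp only [decide_eq_true_eq, hTd] at h ⊢
    obtain ⟨n, hn, p, hp, hl, he⟩ := h
    exact ⟨n, hn.trans_le hs, p, hp, hl, Code.evaln_mono hs he⟩
  · intro a y x
    simp only [decide_eq_true_eq, hTd]
    constructor
    · rintro ⟨s, n, -, p, -, hl, he⟩
      exact ⟨p, (heval p y x).1 (Code.evaln_sound he), hl⟩
    · rintro ⟨p, hp, hl⟩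
      obtain ⟨k, hk⟩ := Code.evaln_complete.1 ((heval p y x).2 hp)
      exact ⟨max k (encode p + 1), encode p, by omega, p, encodek p, hl,
        Code.evaln_mono (le_max_left _ _) hk⟩

/-- The pairing function is quadratic, so pairing at most doubles the binary length, and tuples of
fixed size keep logarithmic length. -/
theorem size_encode_prod_le {α β : Type*} [Encodable α] [Encodable β] {a : α} {b : β} {s : ℕ}
    (ha : (encode a).size ≤ s) (hb : (encode b).size ≤ s) : (encode (a, b)).size ≤ 2 * s := by
  rw [Nat.size_le] at ha hb ⊢
  rw [encode_prod_val]
  refine (Nat.pair_lt_max_add_one_sq _ _).trans_le ?_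
  rw [mul_comm, pow_mul]
  exact Nat.pow_le_pow_left (by omega) 2

/-- The easy direction of the chain rule. -/
theorem IsOptimal.plainC_pairCode_le {U : Decompressor} (hU : IsOptimal U) :
    ∃ c : ℕ, ∀ (x y : List Bool) (s : ℕ), (plainC U x).size ≤ s → (condC U y x).size ≤ s →
      plainC U (pairCode x y) ≤ plainC U x + condC U y x + 4 * s + c := by
  obtain ⟨A, hA, hmono, hAU⟩ := exists_stages hU.1
  let P : ℕ × List Bool × List Bool → List Bool → ℕ × ℕ → List Bool → Prop := fun σ z a _ =>
    z = pairCode σ.2.1 σ.2.2 ∧ A σ.1 a.1 [] σ.2.1 = true ∧ A σ.1 a.2 σ.2.1 σ.2.2 = true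
  have hP : PrimrecPred fun z : (ℕ × List Bool × List Bool) × List Bool × (ℕ × ℕ) × List Bool =>
      P z.1 z.2.1 z.2.2.1 z.2.2.2 := by
    have hσ : Primrec fun z : (ℕ × List Bool × List Bool) × List Bool × (ℕ × ℕ) × List Bool =>
      z.1 := Primrec.fst
    have ha : Primrec fun z : (ℕ × List Bool × List Bool) × List Bool × (ℕ × ℕ) × List Bool =>
      z.2.2.1 := Primrec.fst.comp (Primrec.snd.comp Primrec.snd)
    have h1 := Primrec.fst.comp (Primrec.snd.comp hσ)
    have h2 := Primrec.snd.comp (Primrec.snd.comp hσ)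
    refine (Primrec.eq.comp (Primrec.fst.comp Primrec.snd) (primrec_pairCode.comp h1 h2)).and
      ((Primrec.eq.comp (hA.comp ((Primrec.fst.comp hσ).pair ((Primrec.fst.comp ha).pair
        ((Primrec.const []).pair h1)))) (Primrec.const true)).and
        (Primrec.eq.comp (hA.comp ((Primrec.fst.comp hσ).pair ((Primrec.snd.comp ha).pair
        (h1.pair h2)))) (Primrec.const true)))
  obtain ⟨c, hc⟩ := hU.condC_le_of_enumerable hP.computablePred
  refine ⟨c + 2, fun x y s hx hy => ?_⟩
  obtain ⟨S, hS, hScard⟩ := exists_finset_outputs U (plainC U x) []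
  choose S' hS' hScard' using fun x' => exists_finset_outputs U (condC U y x) x'
  -- The candidates are the pairs (x', y') with C(x') ≤ C(x) and C(y'|x') ≤ C(y|x). Their number is
  -- at most a product of two powers of two, and both bounds are passed as the parameter, at cost
  -- 4s.
  have key := hc (plainC U x, condC U y x) (pairCode x y) [] (plainC U x + 1 + (condC U y x + 1))
    (S.biUnion fun x' => (S' x').image (pairCode x')) ?_ ?_ ?_
  · have : (encode (plainC U x, condC U y x)).size ≤ 2 * s := size_encode_prod_le hx hy
    change condC U (pairCode x y) [] ≤ _
    omega
  · rintro ⟨r, x', y'⟩ z ⟨rfl, h1, h2⟩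
    obtain ⟨p, hp, hpl⟩ := (hAU _ _ _).1 ⟨_, h1⟩
    obtain ⟨p', hp', hpl'⟩ := (hAU _ _ _).1 ⟨_, h2⟩
    exact Finset.mem_biUnion.2 ⟨x', hS _ p hp hpl,
      Finset.mem_image.2 ⟨y', hS' _ _ p' hp' hpl', rfl⟩⟩
  · rw [pow_add]
    exact (Finset.card_biUnion_le_card_mul _ _ _ fun x' _ =>
      Finset.card_image_le.trans (hScard' x')).trans (Nat.mul_le_mul_right _ hScard)
  · obtain ⟨p, hp, hpl⟩ := hU.exists_shortest_program x []
    obtain ⟨p', hp', hpl'⟩ := hU.exists_shortest_program y x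
    obtain ⟨s₁, h₁⟩ := (hAU (plainC U x) [] x).2 ⟨p, hp, hpl.le⟩
    obtain ⟨s₂, h₂⟩ := (hAU (condC U y x) x y).2 ⟨p', hp', hpl'.le⟩
    exact ⟨(max s₁ s₂, x, y), rfl, hmono (le_max_left _ _) h₁, hmono (le_max_right _ _) h₂⟩

/-- A condition increases the complexity at most slightly. -/
theorem IsOptimal.condC_le_plainC {U : Decompressor} (hU : IsOptimal U) :
    ∃ c : ℕ, ∀ x y : List Bool, condC U x y ≤ plainC U x + c := by
  obtain ⟨c, hc⟩ := hU.2 (fun p _ => U p [])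
    (Partrec.comp hU.1 (Computable.fst.pair (Computable.const [])))
  refine ⟨c, fun x y => ?_⟩
  obtain ⟨p, hp, hpl⟩ := hU.exists_shortest_program x []
  obtain ⟨p', hp', hl⟩ := hc p y x hp
  have := condC_le_length hp'
  rw [plainC]
  omega

end KolmogorovMixing

/-! ### Naming the ends of an edge by indices in enumerable neighbourhoods -/

namespace KolmogorovMixing

open Encodable

theorem computablePred_eq_true {α : Type*} [Primcodable α] {b : α → Bool} (h : Computable b) :
    ComputablePred fun z => b z = true :=
  ⟨fun _ => inferInstance, h.of_eq fun z => by simp⟩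

theorem primrec_list_dedup {β : Type*} [Primcodable β] [DecidableEq β] :
    Primrec (List.dedup : List β → List β) := by
  have h : Primrec₂ fun (_ : List β) (p : β × List β) =>
      bif decide (p.1 ∈ p.2) then p.2 else p.1 :: p.2 := by
    have h1 : Primrec fun q : List β × β × List β => q.2.1 := Primrec.fst.comp Primrec.snd
    have h2 : Primrec fun q : List β × β × List β => q.2.2 := Primrec.snd.comp Primrec.snd
    exact Primrec.cond (primrecRel_list_mem.decide.comp h2 h1) h2 (Primrec.list_cons.comp h1 h2)
  refine (Primrec.list_foldr Primrec.id (Primrec.const []) h).of_eq fun l => ?_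
  induction l with
  | nil => rfl
  | cons a l ih =>
    simp only [id, List.foldr_cons] at ih ⊢
    rw [ih]
    by_cases ha : a ∈ l
    · simp [List.dedup_cons_of_mem ha, ha]
    · simp [List.dedup_cons_of_notMem ha, ha]

theorem primrec_countP {γ β : Type*} [Primcodable γ] [Primcodable β] {L : γ → List β}
    {p : γ → β → Bool} (hL : Primrec L) (hp : Primrec₂ p) :
    Primrec fun c => (L c).countP (p c) := by
  have h : Primrec₂ fun (c : γ) (q : β × ℕ) => bif p c q.1 then q.2 + 1 else q.2 := by
    have h1 : Primrec fun z : γ × β × ℕ => z.2.1 := Primrec.fst.comp Primrec.snd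
    have h2 : Primrec fun z : γ × β × ℕ => z.2.2 := Primrec.snd.comp Primrec.snd
    exact Primrec.cond (hp.comp Primrec.fst h1) (Primrec.succ.comp h2) h2
  refine (Primrec.list_foldr hL (Primrec.const 0) h).of_eq fun c => ?_
  induction L c with
  | nil => rfl
  | cons a l ih =>
    rw [List.foldr_cons, ih, List.countP_cons]
    cases p c a <;> simp

/-- The number of left neighbours of `y` that belong to `A`. -/
def leftCount (l : List (List Bool × List Bool)) (A : List Bool → Bool) (y : List Bool) : ℕ :=
  l.countP fun e => decide (e.2 = y) && A e.1

/-- The number of right neighbours of `x` that have at least `M` left neighbours in `A`. -/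
def rightCount (l : List (List Bool × List Bool)) (A : List Bool → Bool) (M : ℕ)
    (x : List Bool) : ℕ :=
  l.countP fun e => decide (e.1 = x) && decide (M ≤ leftCount l A e.2)

theorem leftCount_mono {l : List (List Bool × List Bool)} {A A' : List Bool → Bool}
    (h : ∀ e ∈ l, A e.1 = true → A' e.1 = true) (y : List Bool) :
    leftCount l A y ≤ leftCount l A' y := by
  refine List.countP_mono_left fun e he h' => ?_
  simp only [Bool.and_eq_true] at h' ⊢
  exact ⟨h'.1, h e he h'.2⟩

/-- The count depends only positively on A. Hence lower bounds on it, once seen at some stage of the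
enumeration of A, stay true. -/
theorem rightCount_mono {l : List (List Bool × List Bool)} {A A' : List Bool → Bool}
    (h : ∀ e ∈ l, A e.1 = true → A' e.1 = true) (M : ℕ) (x : List Bool) :
    rightCount l A M x ≤ rightCount l A' M x := by
  refine List.countP_mono_left fun e he h' => ?_
  simp only [Bool.and_eq_true, decide_eq_true_eq] at h' ⊢
  exact ⟨h'.1, h'.2.trans (leftCount_mono h _)⟩

theorem card_toFinset_filter {β : Type*} [DecidableEq β] {l : List β} (hl : l.Nodup)
    (p : β → Bool) : (l.toFinset.filter fun e => p e = true).card = l.countP p := by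
  rw [← List.toFinset_filter, List.toFinset_card_of_nodup (hl.filter _),
    List.countP_eq_length_filter]

section primrec

variable {γ : Type*} [Primcodable γ] {l : γ → List (List Bool × List Bool)}
  {A : γ → List Bool → Bool} {M : γ → ℕ} {x : γ → List Bool}

theorem primrec_leftCount (hl : Primrec l) (hA : Primrec₂ A) (hx : Primrec x) :
    Primrec fun c => leftCount (l c) (A c) (x c) := by
  refine primrec_countP hl (Primrec.and.comp ?_ ?_)
  · exact Primrec.eq.decide.comp (Primrec.snd.comp Primrec.snd) (hx.comp Primrec.fst)
  · exact hA.comp Primrec.fst (Primrec.fst.comp Primrec.snd)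

theorem primrec_rightCount (hl : Primrec l) (hA : Primrec₂ A) (hM : Primrec M) (hx : Primrec x) :
    Primrec fun c => rightCount (l c) (A c) (M c) (x c) := by
  refine primrec_countP hl (Primrec.and.comp ?_ ?_)
  · exact Primrec.eq.decide.comp (Primrec.fst.comp Primrec.snd) (hx.comp Primrec.fst)
  · refine Primrec.nat_le.decide.comp (hM.comp Primrec.fst)
      (primrec_leftCount (hl.comp Primrec.fst) ?_ (Primrec.snd.comp Primrec.snd))
    exact hA.comp (Primrec.fst.comp Primrec.fst) Primrec.snd

end primrec

theorem computable_two_pow {γ : Type*} [Primcodable γ] {f : γ → ℕ} (hf : Primrec f) :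
    Computable fun c => 2 ^ f c :=
  ((Primrec₂.unpaired'.1 Nat.Primrec.pow).comp (Primrec.const 2) hf).to_comp

/-- A left vertex of the level set `A` can be specified by its index among the neighbours in `A`
of a given right vertex. -/
theorem IsOptimal.exists_condC_le_of_leftCount {U : Decompressor} (hU : IsOptimal U)
    {A : ℕ → ℕ → List Bool → List Bool → Bool}
    (hA : Primrec fun z : ℕ × ℕ × List Bool × List Bool => A z.1 z.2.1 z.2.2.1 z.2.2.2)
    {l : ℕ → ℕ → List (List Bool × List Bool)} (hl : Computable₂ l) (hnd : ∀ k d, (l k d).Nodup) :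
    ∃ c : ℕ, ∀ (k d a s₀ m : ℕ) (x y w : List Bool), (x, y) ∈ l k d → A s₀ a w x = true →
      (∀ s, ∀ e ∈ l k d, A s a w e.1 = true → A s₀ a w e.1 = true) →
      leftCount (l k d) (A s₀ a w) y ≤ 2 ^ m →
      condC U x (pairCode y w) ≤ m + 2 * (encode (k, d, a)).size + c := by
  let Z := (ℕ × List Bool × List Bool) × List Bool × (ℕ × ℕ × ℕ) × List Bool
  -- The condition is not decoded: the witness guesses y and w, and their pair code is compared with
  -- the condition. Injectivity makes the guess unique.
  let b : Z → Bool := fun z =>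
    decide (pairCode z.1.2.1 z.1.2.2 = z.2.2.2) &&
      (decide ((z.2.1, z.1.2.1) ∈ l z.2.2.1.1 z.2.2.1.2.1) &&
        A z.1.1 z.2.2.1.2.2 z.1.2.2 z.2.1)
  have hb : Computable b := by
    have hσ : Primrec fun z : Z => z.1 := Primrec.fst
    have hy : Primrec fun z : Z => z.1.2.1 := Primrec.fst.comp (Primrec.snd.comp hσ)
    have hw : Primrec fun z : Z => z.1.2.2 := Primrec.snd.comp (Primrec.snd.comp hσ)
    have hx : Primrec fun z : Z => z.2.1 := Primrec.fst.comp Primrec.snd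
    have hp : Primrec fun z : Z => z.2.2.1 := Primrec.fst.comp (Primrec.snd.comp Primrec.snd)
    have hq : Primrec fun z : Z => z.2.2.2 := Primrec.snd.comp (Primrec.snd.comp Primrec.snd)
    have hpd := Primrec.snd.comp hp
    have h1 : Primrec fun z : Z => decide (pairCode z.1.2.1 z.1.2.2 = z.2.2.2) :=
      Primrec.eq.decide.comp (primrec_pairCode.comp hy hw) hq
    have h2 : Primrec fun z : Z => A z.1.1 z.2.2.1.2.2 z.1.2.2 z.2.1 :=
      hA.comp ((Primrec.fst.comp hσ).pair ((Primrec.snd.comp hpd).pair (hw.pair hx)))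
    have h3 : Computable fun z : Z => l z.2.2.1.1 z.2.2.1.2.1 :=
      hl.comp (Primrec.fst.comp hp).to_comp (Primrec.fst.comp hpd).to_comp
    exact Primrec.and.to_comp.comp h1.to_comp (Primrec.and.to_comp.comp
      (primrecRel_list_mem.decide.to_comp.comp h3 (hx.pair hy).to_comp) h2.to_comp)
  obtain ⟨c, hc⟩ := hU.condC_le_of_enumerable
    (P := fun σ z a y => b (σ, z, a, y) = true) (computablePred_eq_true hb)
  refine ⟨c, fun k d a s₀ m x y w hxy hx hs hm => ?_⟩
  refine hc (k, d, a) x (pairCode y w) m (((l k d).toFinset.filter fun e =>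
    (decide (e.2 = y) && A s₀ a w e.1) = true).image Prod.fst) ?_ ?_ ?_
  · rintro ⟨s, y', w'⟩ z h
    simp only [b, Bool.and_eq_true, decide_eq_true_eq] at h
    obtain ⟨h1, h2, h3⟩ := h
    obtain ⟨rfl, rfl⟩ := pairCode_injective h1
    exact Finset.mem_image.2 ⟨(z, y'), by simpa using ⟨h2, hs s _ h2 h3⟩, rfl⟩
  · refine Finset.card_image_le.trans ?_
    rw [card_toFinset_filter (hnd k d)]
    exact hm
  · exact ⟨(s₀, y, w), by simpa [b] using ⟨hxy, hx⟩⟩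

/-- A right vertex with many neighbours in the level set `A` can be specified by its index among
the neighbours of a given left vertex that have this property. -/
theorem IsOptimal.exists_condC_le_of_rightCount {U : Decompressor} (hU : IsOptimal U)
    {A : ℕ → ℕ → List Bool → List Bool → Bool}
    (hA : Primrec fun z : ℕ × ℕ × List Bool × List Bool => A z.1 z.2.1 z.2.2.1 z.2.2.2)
    {l : ℕ → ℕ → List (List Bool × List Bool)} (hl : Computable₂ l) (hnd : ∀ k d, (l k d).Nodup) :
    ∃ c : ℕ, ∀ (k d a m s₀ t : ℕ) (x y w : List Bool), (x, y) ∈ l k d →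
      2 ^ m ≤ leftCount (l k d) (A s₀ a w) y →
      (∀ s, ∀ e ∈ l k d, A s a w e.1 = true → A s₀ a w e.1 = true) →
      rightCount (l k d) (A s₀ a w) (2 ^ m) x ≤ 2 ^ t →
      condC U y (pairCode w x) ≤ t + 2 * (encode (k, d, a, m)).size + c := by
  let Z := (ℕ × List Bool × List Bool) × List Bool × (ℕ × ℕ × ℕ × ℕ) × List Bool
  let b : Z → Bool := fun z =>
    decide (pairCode z.1.2.1 z.1.2.2 = z.2.2.2) &&
      (decide ((z.1.2.2, z.2.1) ∈ l z.2.2.1.1 z.2.2.1.2.1) &&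
        decide (2 ^ z.2.2.1.2.2.2 ≤ leftCount (l z.2.2.1.1 z.2.2.1.2.1)
          (A z.1.1 z.2.2.1.2.2.1 z.1.2.1) z.2.1))
  have hb : Computable b := by
    have hσ : Primrec fun z : Z => z.1 := Primrec.fst
    have hw : Primrec fun z : Z => z.1.2.1 := Primrec.fst.comp (Primrec.snd.comp hσ)
    have hx : Primrec fun z : Z => z.1.2.2 := Primrec.snd.comp (Primrec.snd.comp hσ)
    have hy : Primrec fun z : Z => z.2.1 := Primrec.fst.comp Primrec.snd
    have hp : Primrec fun z : Z => z.2.2.1 := Primrec.fst.comp (Primrec.snd.comp Primrec.snd)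
    have hq : Primrec fun z : Z => z.2.2.2 := Primrec.snd.comp (Primrec.snd.comp Primrec.snd)
    have hpd := Primrec.snd.comp hp
    have hpa := Primrec.snd.comp hpd
    have h1 : Primrec fun z : Z => decide (pairCode z.1.2.1 z.1.2.2 = z.2.2.2) :=
      Primrec.eq.decide.comp (primrec_pairCode.comp hw hx) hq
    have h3 : Computable fun z : Z => l z.2.2.1.1 z.2.2.1.2.1 :=
      hl.comp (Primrec.fst.comp hp).to_comp (Primrec.fst.comp hpd).to_comp
    have h2 : Primrec fun v : List (List Bool × List Bool) × Z =>
        leftCount v.1 (A v.2.1.1 v.2.2.2.1.2.2.1 v.2.1.2.1) v.2.2.1 :=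
      primrec_leftCount Primrec.fst (hA.comp (((Primrec.fst.comp hσ).comp (Primrec.snd.comp
        Primrec.fst)).pair (((Primrec.fst.comp hpa).comp (Primrec.snd.comp Primrec.fst)).pair
        ((hw.comp (Primrec.snd.comp Primrec.fst)).pair Primrec.snd)))) (hy.comp Primrec.snd)
    have h4 := h2.to_comp.comp (g := fun z : Z => (l z.2.2.1.1 z.2.2.1.2.1, z))
      (h3.pair Computable.id)
    exact Primrec.and.to_comp.comp h1.to_comp (Primrec.and.to_comp.comp
      (primrecRel_list_mem.decide.to_comp.comp h3 (hx.pair hy).to_comp)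
      (Primrec.nat_le.decide.to_comp.comp
        (computable_two_pow (Primrec.snd.comp hpa)) h4))
  obtain ⟨c, hc⟩ := hU.condC_le_of_enumerable
    (P := fun σ z a y => b (σ, z, a, y) = true) (computablePred_eq_true hb)
  refine ⟨c, fun k d a m s₀ t x y w hxy hy hs ht => ?_⟩
  refine hc (k, d, a, m) y (pairCode w x) t (((l k d).toFinset.filter fun e =>
    (decide (e.1 = x) && decide (2 ^ m ≤ leftCount (l k d) (A s₀ a w) e.2)) = true).image
      Prod.snd) ?_ ?_ ?_
  · rintro ⟨s, w', x'⟩ z h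
    simp only [b, Bool.and_eq_true, decide_eq_true_eq] at h
    obtain ⟨h1, h2, h3⟩ := h
    obtain ⟨rfl, rfl⟩ := pairCode_injective h1
    exact Finset.mem_image.2 ⟨(x', z), by
      simpa using ⟨h2, h3.trans (leftCount_mono (hs s) z)⟩, rfl⟩
  · refine Finset.card_image_le.trans ?_
    rw [card_toFinset_filter (hnd k d)]
    exact ht
  · exact ⟨(s₀, w, x), by simpa [b] using ⟨hxy, hy⟩⟩

/-- A left vertex with many neighbours that have themselves many neighbours in the level set `A`
can be specified by its index among all left vertices in `A` with this property. -/
theorem IsOptimal.exists_condC_le_of_card {U : Decompressor} (hU : IsOptimal U)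
    {A : ℕ → ℕ → List Bool → List Bool → Bool}
    (hA : Primrec fun z : ℕ × ℕ × List Bool × List Bool => A z.1 z.2.1 z.2.2.1 z.2.2.2)
    {l : ℕ → ℕ → List (List Bool × List Bool)} (hl : Computable₂ l) :
    ∃ c : ℕ, ∀ (k d a m t s₀ r : ℕ) (x w : List Bool),
      A s₀ a w x = true → 2 ^ t ≤ rightCount (l k d) (A s₀ a w) (2 ^ m) x →
      (∀ s, ∀ e ∈ l k d, A s a w e.1 = true → A s₀ a w e.1 = true) →
      (((l k d).toFinset.image Prod.fst).filter fun x' => A s₀ a w x' = true ∧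
        2 ^ t ≤ rightCount (l k d) (A s₀ a w) (2 ^ m) x').card ≤ 2 ^ r →
      condC U x w ≤ r + 2 * (encode (k, d, a, m, t)).size + c := by
  let Z := ℕ × List Bool × (ℕ × ℕ × ℕ × ℕ × ℕ) × List Bool
  let b : Z → Bool := fun z =>
    A z.1 z.2.2.1.2.2.1 z.2.2.2 z.2.1 &&
      decide (2 ^ z.2.2.1.2.2.2.2 ≤ rightCount (l z.2.2.1.1 z.2.2.1.2.1)
          (A z.1 z.2.2.1.2.2.1 z.2.2.2) (2 ^ z.2.2.1.2.2.2.1) z.2.1)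
  have hb : Computable b := by
    have hσ : Primrec fun z : Z => z.1 := Primrec.fst
    have hx : Primrec fun z : Z => z.2.1 := Primrec.fst.comp Primrec.snd
    have hp : Primrec fun z : Z => z.2.2.1 := Primrec.fst.comp (Primrec.snd.comp Primrec.snd)
    have hw : Primrec fun z : Z => z.2.2.2 := Primrec.snd.comp (Primrec.snd.comp Primrec.snd)
    have hpd := Primrec.snd.comp hp
    have hpa := Primrec.snd.comp hpd
    have hpm := Primrec.snd.comp hpa
    have h1 : Primrec fun z : Z => A z.1 z.2.2.1.2.2.1 z.2.2.2 z.2.1 :=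
      hA.comp (hσ.pair ((Primrec.fst.comp hpa).pair (hw.pair hx)))
    have h3 : Computable fun z : Z => l z.2.2.1.1 z.2.2.1.2.1 :=
      hl.comp (Primrec.fst.comp hp).to_comp (Primrec.fst.comp hpd).to_comp
    have h2 : Primrec fun v : (List (List Bool × List Bool) × ℕ) × Z =>
        rightCount v.1.1 (A v.2.1 v.2.2.2.1.2.2.1 v.2.2.2.2) v.1.2 v.2.2.1 :=
      primrec_rightCount (Primrec.fst.comp Primrec.fst)
        (hA.comp ((hσ.comp (Primrec.snd.comp Primrec.fst)).pair
          (((Primrec.fst.comp hpa).comp (Primrec.snd.comp Primrec.fst)).pair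
          ((hw.comp (Primrec.snd.comp Primrec.fst)).pair Primrec.snd))))
        (Primrec.snd.comp Primrec.fst) (hx.comp Primrec.snd)
    have h4 := h2.to_comp.comp
      (g := fun z : Z => ((l z.2.2.1.1 z.2.2.1.2.1, 2 ^ z.2.2.1.2.2.2.1), z))
      ((h3.pair (computable_two_pow (Primrec.fst.comp hpm))).pair Computable.id)
    exact Primrec.and.to_comp.comp h1.to_comp (Primrec.nat_le.decide.to_comp.comp
        (computable_two_pow (Primrec.snd.comp hpm)) h4)
  obtain ⟨c, hc⟩ := hU.condC_le_of_enumerable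
    (P := fun σ z a y => b (σ, z, a, y) = true) (computablePred_eq_true hb)
  refine ⟨c, fun k d a m t s₀ r x w hx ht hs hr => ?_⟩
  refine hc (k, d, a, m, t) x w r _ ?_ hr ⟨s₀, by simpa [b] using ⟨hx, ht⟩⟩
  intro s z h
  simp only [b, Bool.and_eq_true, decide_eq_true_eq] at h
  obtain ⟨h1, h2⟩ := h
  have h3 : 2 ^ t ≤ rightCount (l k d) (A s₀ a w) (2 ^ m) z :=
    h2.trans (rightCount_mono (hs s) _ _)
  -- A positive count shows that z is an end of a listed edge, where the stage s₀ is known to be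
  -- final.
  obtain ⟨e, he, hez⟩ := List.countP_pos_iff.1 ((Nat.two_pow_pos t).trans_le h3)
  simp only [Bool.and_eq_true, decide_eq_true_eq] at hez
  obtain ⟨rfl, -⟩ := hez
  exact Finset.mem_filter.2 ⟨Finset.mem_image.2 ⟨e, List.mem_toFinset.2 he, rfl⟩,
    hs s e he h1, h3⟩

end KolmogorovMixing

/-! ### The mixing lemma applied to the level sets -/

namespace KolmogorovMixing

open Encodable

/-- In a good expander, if `2 ^ r` vertices of a set `A` of left vertices have each at least `2 ^ t`
neighbours that are adjacent to at least `2 ^ m` elements of `A`, then either `2 ^ m` is close to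
the expected number `|A| / q` or `2 ^ (r + t + m)` is bounded by the number of edges from `A`. -/
theorem BipartiteGraph.HasParameters.mixing_bound {G : BipartiteGraph} {q d : ℕ} (hd : 1 ≤ d)
    (hq : 2 ≤ q) (hpar : G.HasParameters q d) (hexp : G.IsGoodSpectralExpander (q ^ d) q)
    {l : List (List Bool × List Bool)} (hnd : l.Nodup) (hl : l.toFinset = G.E)
    {A : List Bool → Bool} {a m t r : ℕ}
    (hA : ((l.toFinset.image Prod.fst).filter fun x => A x = true).card ≤ a)
    (hne : ∃ e ∈ l, 2 ^ m ≤ leftCount l A e.2)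
    (hr : 2 ^ r ≤ ((l.toFinset.image Prod.fst).filter fun x => A x = true ∧
        2 ^ t ≤ rightCount l A (2 ^ m) x).card) :
    2 ^ m * q ≤ 2 * a ∨ 2 ^ r * 2 ^ t * 2 ^ m ≤ 4 * q ^ d * a := by
  rw [hl] at hA hr
  set AL := (G.E.image Prod.fst).filter fun x => A x = true with hAL
  set A' := (G.E.image Prod.fst).filter fun x => A x = true ∧
        2 ^ t ≤ rightCount l A (2 ^ m) x with hA'
  set BR := (G.E.image Prod.snd).filter fun y => 2 ^ m ≤ leftCount l A y with hBR
  set F := G.E.filter fun e => e.1 ∈ AL ∧ e.2 ∈ BR with hF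
  have hAL_sub : AL ⊆ G.L := by
    intro x hx
    obtain ⟨e, he, rfl⟩ := Finset.mem_image.1 (Finset.mem_filter.1 hx).1
    exact (Finset.mem_product.1 (G.E_subset he)).1
  have hBR_sub : BR ⊆ G.R := by
    intro x hx
    obtain ⟨e, he, rfl⟩ := Finset.mem_image.1 (Finset.mem_filter.1 hx).1
    exact (Finset.mem_product.1 (G.E_subset he)).2
  -- The edges between the two sets are bounded from below twice: grouped here by their right ends,
  -- and next by their left ends in A'.
  have hBF : BR.card * 2 ^ m ≤ F.card := by
    rw [Finset.card_eq_sum_card_fiberwise (f := Prod.snd) (t := BR)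
      (fun e he => (Finset.mem_filter.1 he).2.2), ← smul_eq_mul]
    refine Finset.card_nsmul_le_sum _ _ _ fun y hy => ?_
    refine (Finset.mem_filter.1 hy).2.trans ?_
    rw [leftCount, ← card_toFinset_filter hnd, hl]
    refine Finset.card_le_card fun e he => ?_
    simp only [Finset.mem_filter, Bool.and_eq_true, decide_eq_true_eq] at he
    obtain ⟨he, rfl, h⟩ := he
    exact Finset.mem_filter.2 ⟨Finset.mem_filter.2 ⟨he, Finset.mem_filter.2
      ⟨Finset.mem_image_of_mem _ he, h⟩, hy⟩, rfl⟩
  have hAF : A'.card * 2 ^ t ≤ F.card := by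
    refine le_trans ?_ (Finset.card_le_card (Finset.filter_subset (fun e => e.1 ∈ A') F))
    have hmaps : Set.MapsTo Prod.fst (F.filter fun e => e.1 ∈ A' : Set (List Bool × List Bool))
        (A' : Set (List Bool)) := fun e he => (Finset.mem_filter.1 (Finset.mem_coe.1 he)).2
    rw [Finset.card_eq_sum_card_fiberwise hmaps, ← smul_eq_mul]
    refine Finset.card_nsmul_le_sum _ _ _ fun x hx => ?_
    refine (Finset.mem_filter.1 hx).2.2.trans ?_
    rw [rightCount, ← card_toFinset_filter hnd, hl]
    refine Finset.card_le_card fun e he => ?_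
    simp only [Finset.mem_filter, Bool.and_eq_true, decide_eq_true_eq] at he
    obtain ⟨he, rfl, h⟩ := he
    exact Finset.mem_filter.2 ⟨Finset.mem_filter.2 ⟨Finset.mem_filter.2 ⟨he, Finset.mem_filter.2
      ⟨Finset.mem_image_of_mem _ he, (Finset.mem_filter.1 hx).2.1⟩, Finset.mem_filter.2
      ⟨Finset.mem_image_of_mem _ he, h⟩⟩, hx⟩, rfl⟩
  have hB0 : 0 < BR.card := by
    obtain ⟨e, he, h⟩ := hne
    refine Finset.card_pos.2 ⟨e.2, Finset.mem_filter.2 ⟨Finset.mem_image_of_mem _ ?_, h⟩⟩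
    rw [← hl]
    exact List.mem_toFinset.2 he
  obtain ⟨h1, hlam⟩ := hexp.2
  have hq0 : (0 : ℝ) < q := by positivity
  have hmax : max (q ^ d) q = q ^ d := max_eq_left (Nat.le_self_pow (by omega) q)
  rw [hmax] at hlam
  -- The gap below the top eigenvalue √(q^d·q) needs q ≥ 2.
  have hlt : Real.sqrt ((q ^ d : ℕ) : ℝ) < Real.sqrt (((q ^ d : ℕ) : ℝ) * q) := by
    refine Real.sqrt_lt_sqrt (by positivity) (lt_mul_of_one_lt_right (by positivity) ?_)
    exact_mod_cast hq
  have hmix := mixing hpar.2.2 h1 hlam hlt (by positivity) (Real.sqrt_nonneg _) hAL_sub hBR_sub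
  rw [hpar.2.1, ← hF] at hmix
  have hdiv : ((q ^ d : ℕ) : ℝ) * AL.card * BR.card / ((q ^ (d + 1) : ℕ) : ℝ) =
      AL.card * BR.card / q := by
    push_cast
    rw [pow_succ]
    field_simp
  rw [hdiv, ← Real.sqrt_mul (by positivity)] at hmix
  have hBF' : (BR.card : ℝ) * 2 ^ m ≤ F.card := by exact_mod_cast hBF
  have hAF' : (A'.card : ℝ) * 2 ^ t ≤ F.card := by exact_mod_cast hAF
  have hB0' : (0 : ℝ) < BR.card := by exact_mod_cast hB0
  have hA'' : (AL.card : ℝ) ≤ a := by exact_mod_cast hA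
  have hr' : (2 : ℝ) ^ r ≤ A'.card := by exact_mod_cast hr
  have hF0 : (0 : ℝ) < F.card := lt_of_lt_of_le (by positivity) hBF'
  set S := Real.sqrt (((q ^ d : ℕ) : ℝ) * (AL.card * BR.card)) with hS
  rcases le_total S (AL.card * BR.card / q) with hc | hc
  · left
    have h2 : (BR.card : ℝ) * 2 ^ m ≤ 2 * (AL.card * BR.card / q) := by linarith
    have h3 : (BR.card : ℝ) * (2 ^ m * q) ≤ BR.card * (2 * AL.card) := by
      have h4 := mul_le_mul_of_nonneg_right h2 hq0.le
      have h5 : 2 * ((AL.card : ℝ) * BR.card / q) * q = BR.card * (2 * AL.card) := by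
        field_simp
      rw [h5] at h4
      linarith
    have h4 := le_of_mul_le_mul_left h3 hB0'
    have h5 : (2 : ℝ) ^ m * q ≤ 2 * a := by linarith
    exact_mod_cast h5
  · right
    have h2 : (F.card : ℝ) ≤ 2 * S := by linarith
    have hSS : S * S = ((q ^ d : ℕ) : ℝ) * (AL.card * BR.card) :=
      Real.mul_self_sqrt (by positivity)
    have h3 : (F.card : ℝ) * F.card ≤ 4 * (((q ^ d : ℕ) : ℝ) * (AL.card * BR.card)) := by
      rw [← hSS]
      nlinarith
    -- The unknown |B| in F² ≤ 4 q^d |A||B| is eliminated by |B|·2^m ≤ F, after which one factor F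
    -- cancels.
    have h4 : (F.card : ℝ) * (F.card * 2 ^ m) ≤ F.card * (4 * ((q ^ d : ℕ) : ℝ) * AL.card) :=
      calc (F.card : ℝ) * (F.card * 2 ^ m) = F.card * F.card * 2 ^ m := by ring
        _ ≤ 4 * (((q ^ d : ℕ) : ℝ) * (AL.card * BR.card)) * 2 ^ m :=
          mul_le_mul_of_nonneg_right h3 (by positivity)
        _ = 4 * ((q ^ d : ℕ) : ℝ) * AL.card * (BR.card * 2 ^ m) := by ring
        _ ≤ 4 * ((q ^ d : ℕ) : ℝ) * AL.card * F.card :=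
          mul_le_mul_of_nonneg_left hBF' (by positivity)
        _ = _ := by ring
    have h5 := le_of_mul_le_mul_left h4 hF0
    have h6 : (2 : ℝ) ^ r * 2 ^ t * 2 ^ m ≤ 4 * ((q ^ d : ℕ) : ℝ) * a :=
      calc (2 : ℝ) ^ r * 2 ^ t * 2 ^ m ≤ A'.card * 2 ^ t * 2 ^ m := by gcongr
        _ ≤ F.card * 2 ^ m := by gcongr
        _ ≤ 4 * ((q ^ d : ℕ) : ℝ) * AL.card := h5
        _ ≤ _ := by gcongr
    exact_mod_cast h6

/-- Only finitely many elements matter, so by monotonicity the maximum of the stages at which they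
appear is final for all of them. This stage is not computable; it serves only to fix the sets being
counted. -/
theorem exists_stable_stage {β : Type*} {A : ℕ → β → Bool}
    (hmono : ∀ {s s' x}, s ≤ s' → A s x = true → A s' x = true) (l : List β) :
    ∃ s₀, ∀ s, ∀ e ∈ l, A s e = true → A s₀ e = true := by
  induction l with
  | nil => exact ⟨0, by simp⟩
  | cons e l ih =>
    obtain ⟨s₀, h⟩ := ih
    by_cases he : ∃ s, A s e = true
    · obtain ⟨s₁, h₁⟩ := he
      refine ⟨max s₀ s₁, fun s e' he' h' => ?_⟩
      rcases List.mem_cons.1 he' with rfl | he'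
      · exact hmono (le_max_right _ _) h₁
      · exact hmono (le_max_left _ _) (h s e' he' h')
    · refine ⟨s₀, fun s e' he' h' => ?_⟩
      rcases List.mem_cons.1 he' with rfl | he'
      · exact absurd ⟨s, h'⟩ he
      · exact h s e' he' h'

/-- Upper bounds for the complexities of the ends of an edge, given `w`, in terms of numbers
that satisfy the inequality of the mixing lemma. -/
theorem IsOptimal.exists_mixing_profile {U : Decompressor} (hU : IsOptimal U)
    {G : ℕ → ℕ → BipartiteGraph} (hG : IsExplicit G) :
    ∃ c : ℕ, ∀ k d q : ℕ, 1 ≤ d → 2 ≤ q → (G k d).HasParameters q d →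
      (G k d).IsGoodSpectralExpander (q ^ d) q → ∀ x y w : List Bool, (x, y) ∈ (G k d).E →
      ∃ m t r : ℕ, 2 ^ m ≤ q ^ (d + 3) ∧ 2 ^ t ≤ q ^ (d + 3) ∧
        (2 ^ m * q ≤ 2 * 2 ^ (condC U x w + 1) ∨
          2 ^ r * 2 ^ t * 2 ^ m ≤ 4 * q ^ d * 2 ^ (condC U x w + 1)) ∧
        ∀ s : ℕ, k.size ≤ s → d.size ≤ s → (condC U x w).size ≤ s → m.size ≤ s → t.size ≤ s →
          condC U x (pairCode y w) ≤ m + 32 * s + c ∧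
          condC U y (pairCode w x) ≤ t + 32 * s + c ∧
          condC U x w ≤ r + 32 * s + c := by
  obtain ⟨_, _, e, _, _, he, hGe⟩ := hG
  obtain ⟨A, hA, hmono, hAU⟩ := exists_stages hU.1
  set l : ℕ → ℕ → List (List Bool × List Bool) := fun k d => (e k d).dedup with hl
  have hlc : Computable₂ l := primrec_list_dedup.to_comp.comp he
  have hnd : ∀ k d, (l k d).Nodup := fun k d => List.nodup_dedup _
  have hlE : ∀ k d, (l k d).toFinset = (G k d).E := fun k d => by
    rw [← (hGe k d).2.2]
    ext z
    simp [hl]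
  obtain ⟨c₁, hc₁⟩ := hU.exists_condC_le_of_leftCount hA hlc hnd
  obtain ⟨c₂, hc₂⟩ := hU.exists_condC_le_of_rightCount hA hlc hnd
  obtain ⟨c₃, hc₃⟩ := hU.exists_condC_le_of_card hA hlc
  -- The extra 1 pays for rounding the binary logarithms of the three cardinalities.
  refine ⟨c₁ + c₂ + c₃ + 1, fun k d q hd hq hpar hexp x y w hxy => ?_⟩
  set a := condC U x w with ha
  have hxyl : (x, y) ∈ l k d := by rwa [← List.mem_toFinset, hlE]
  obtain ⟨s₀, hs₀⟩ := exists_stable_stage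
    (A := fun s (e : List Bool × List Bool) => A s a w e.1) (fun hs h => hmono hs h) (l k d)
  have hx : A s₀ a w x = true := by
    obtain ⟨p, hp, hpl⟩ := hU.exists_shortest_program x w
    obtain ⟨s, hs⟩ := (hAU a w x).2 ⟨p, hp, hpl.le⟩
    exact hs₀ s (x, y) hxyl hs
  set τ := leftCount (l k d) (A s₀ a w) y with hτ
  set m := Nat.log 2 τ with hm
  set ρ := rightCount (l k d) (A s₀ a w) (2 ^ m) x with hρ
  set t := Nat.log 2 ρ with ht
  set A' := ((l k d).toFinset.image Prod.fst).filter fun x' => A s₀ a w x' = true ∧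
        2 ^ t ≤ rightCount (l k d) (A s₀ a w) (2 ^ m) x' with hA'
  have hτ0 : τ ≠ 0 := (List.countP_pos_iff.2 ⟨(x, y), hxyl, by simpa using hx⟩).ne'
  have hm1 : 2 ^ m ≤ τ := Nat.pow_log_le_self 2 hτ0
  have hm2 : τ ≤ 2 ^ (m + 1) := (Nat.lt_pow_succ_log_self (by norm_num) τ).le
  have hρ0 : ρ ≠ 0 := (List.countP_pos_iff.2 ⟨(x, y), hxyl, by simpa using hm1⟩).ne'
  have ht1 : 2 ^ t ≤ ρ := Nat.pow_log_le_self 2 hρ0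
  have ht2 : ρ ≤ 2 ^ (t + 1) := (Nat.lt_pow_succ_log_self (by norm_num) ρ).le
  have hxA' : x ∈ A' := Finset.mem_filter.2 ⟨Finset.mem_image.2 ⟨(x, y),
    List.mem_toFinset.2 hxyl, rfl⟩, hx, ht1⟩
  have hr1 : 2 ^ Nat.log 2 A'.card ≤ A'.card :=
    Nat.pow_log_le_self 2 (Finset.card_pos.2 ⟨x, hxA'⟩).ne'
  have hr2 : A'.card ≤ 2 ^ (Nat.log 2 A'.card + 1) :=
    (Nat.lt_pow_succ_log_self (by norm_num) _).le
  -- The crude bound |L||R| on the number of edges; it only serves to make m and t short enough to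
  -- be parameters.
  have hlen : (l k d).length ≤ q ^ (d + 3) := by
    rw [← List.toFinset_card_of_nodup (hnd k d), hlE]
    refine (Finset.card_le_card (G k d).E_subset).trans ?_
    rw [Finset.card_product, hpar.1, hpar.2.1, ← pow_add]
    exact (by ring_nf : q ^ (2 + (d + 1)) = q ^ (d + 3)).le
  obtain ⟨S, hS, hScard⟩ := exists_finset_outputs U a w
  have hAcard : (((l k d).toFinset.image Prod.fst).filter fun x => A s₀ a w x = true).card ≤
      2 ^ (a + 1) := by
    refine (Finset.card_le_card fun z hz => ?_).trans hScard
    obtain ⟨p, hp, hpl⟩ := (hAU a w z).1 ⟨s₀, (Finset.mem_filter.1 hz).2⟩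
    exact hS z p hp hpl
  refine ⟨m, t, Nat.log 2 A'.card, hm1.trans (List.countP_le_length.trans hlen),
    ht1.trans (List.countP_le_length.trans hlen),
    hpar.mixing_bound hd hq hexp (hnd k d) (hlE k d) hAcard ⟨(x, y), hxyl, hm1⟩ hr1, ?_⟩
  intro s hks hds has hms hts
  have b1 := hc₁ k d a s₀ (m + 1) x y w hxyl hx hs₀ hm2
  have b2 := hc₂ k d a m s₀ (t + 1) x y w hxyl hm1 hs₀ ht2
  have b3 := hc₃ k d a m t s₀ (Nat.log 2 A'.card + 1) x w hx ht1 hs₀ hr2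
  have w1 : ∀ n : ℕ, n.size ≤ s → (encode n).size ≤ s := fun n h => h
  -- Four nested pairings in the longest tuple give 16s, used for all three; doubling the bits of
  -- the parameter makes it 32s.
  have z1 : (encode (k, d, a)).size ≤ 16 * s := by
    refine (size_encode_prod_le (s := 2 * s) ((w1 k hks).trans (by omega))
      (size_encode_prod_le (w1 d hds) (w1 a has))).trans (by omega)
  have z2 : (encode (k, d, a, m)).size ≤ 16 * s := by
    refine (size_encode_prod_le (s := 4 * s) ((w1 k hks).trans (by omega))
      ((size_encode_prod_le (s := 2 * s) ((w1 d hds).trans (by omega))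
      (size_encode_prod_le (w1 a has) (w1 m hms))).trans (by omega))).trans (by omega)
  have z3 : (encode (k, d, a, m, t)).size ≤ 16 * s := by
    refine (size_encode_prod_le (s := 8 * s) ((w1 k hks).trans (by omega))
      ((size_encode_prod_le (s := 4 * s) ((w1 d hds).trans (by omega))
      ((size_encode_prod_le (s := 2 * s) ((w1 a has).trans (by omega))
      (size_encode_prod_le (w1 m hms) (w1 t hts))).trans (by omega))).trans
        (by omega))).trans (by omega)
  omega

end KolmogorovMixing

/-! ### Passing to logarithms and collecting the error terms -/

namespace KolmogorovMixing

theorem size_le_logb_add_one {n : ℕ} (hn : 1 ≤ n) : (n.size : ℝ) ≤ Real.logb 2 n + 1 := by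
  have h0 : 0 < n.size := Nat.size_pos.2 hn
  have h : 2 ^ (n.size - 1) ≤ n := Nat.lt_size.1 (by omega)
  have h1 : ((n.size - 1 : ℕ) : ℝ) ≤ Real.logb 2 n := by
    rw [Real.le_logb_iff_rpow_le (by norm_num) (by exact_mod_cast hn), Real.rpow_natCast]
    exact_mod_cast h
  rw [Nat.cast_sub h0] at h1
  push_cast at h1
  linarith

theorem natLog_le_logb (n : ℕ) : (Nat.log 2 n : ℝ) ≤ Real.logb 2 n := by
  rcases Nat.eq_zero_or_pos n with rfl | hn
  · simp
  · rw [Real.le_logb_iff_rpow_le (by norm_num) (by exact_mod_cast hn), Real.rpow_natCast]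
    exact_mod_cast Nat.pow_log_le_self 2 hn.ne'

theorem logb_two_pow (m : ℕ) : Real.logb 2 ((2 : ℝ) ^ m) = m := by
  rw [← Real.rpow_natCast, Real.logb_rpow (by norm_num) (by norm_num)]

theorem le_mul_logb_of_two_pow_le {m q e : ℕ} (h : 2 ^ m ≤ q ^ e) :
    (m : ℝ) ≤ e * Real.logb 2 q := by
  have h1 : (2 : ℝ) ^ m ≤ (q : ℝ) ^ e := by exact_mod_cast h
  have h2 := Real.logb_le_logb_of_le (b := 2) (by norm_num) (by positivity) h1
  rwa [logb_two_pow, Real.logb_pow] at h2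

theorem logb_mixing_bound {m q d a r t : ℕ} (hq : 0 < q)
    (h : 2 ^ m * q ≤ 2 * 2 ^ (a + 1) ∨ 2 ^ r * 2 ^ t * 2 ^ m ≤ 4 * q ^ d * 2 ^ (a + 1)) :
    m + Real.logb 2 q ≤ a + 2 ∨ r + t + m ≤ a + 3 + d * Real.logb 2 q := by
  have hq0 : (0 : ℝ) < q := by exact_mod_cast hq
  refine h.imp (fun h => ?_) fun h => ?_
  · have h1 : (2 : ℝ) ^ m * q ≤ 2 ^ (a + 2) := by
      have h2 : 2 ^ m * q ≤ 2 ^ (a + 2) := h.trans_eq (by ring)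
      exact_mod_cast h2
    have h2 := Real.logb_le_logb_of_le (b := 2) (by norm_num) (by positivity) h1
    rw [Real.logb_mul (by positivity) hq0.ne', logb_two_pow, logb_two_pow] at h2
    push_cast at h2
    exact h2
  · have h1 : (2 : ℝ) ^ (r + t + m) ≤ 2 ^ (a + 3) * (q : ℝ) ^ d := by
      have h2 : 2 ^ (r + t + m) ≤ 2 ^ (a + 3) * q ^ d := by
        rw [pow_add, pow_add]
        exact h.trans_eq (by ring)
      exact_mod_cast h2
    have h2 := Real.logb_le_logb_of_le (b := 2) (by norm_num) (by positivity) h1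
    rw [Real.logb_mul (by positivity) (by positivity), logb_two_pow, logb_two_pow,
      Real.logb_pow] at h2
    push_cast at h2
    exact h2

theorem logb_add_two_le (N : ℕ) : Real.logb 2 ((N : ℝ) + 2) ≤ N + 2 := by
  rw [Real.logb_le_iff_le_rpow (by norm_num) (by positivity)]
  have h : (((N + 2 : ℕ) : ℝ)) ≤ (2 : ℝ) ^ (((N + 2 : ℕ) : ℝ)) := by
    rw [Real.rpow_natCast]
    exact_mod_cast (Nat.lt_two_pow_self (n := N + 2)).le
  push_cast at h
  exact h

theorem one_le_logb_add_two (N : ℕ) : 1 ≤ Real.logb 2 ((N : ℝ) + 2) := by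
  rw [Real.le_logb_iff_rpow_le (by norm_num) (by positivity), Real.rpow_one]
  have : (0 : ℝ) ≤ N := Nat.cast_nonneg N
  linarith

end KolmogorovMixing

set_option maxHeartbeats 400000 in
theorem corollary1
    (U : Decompressor) (hU : IsOptimal U)
    (G : ℕ → ℕ → BipartiteGraph) (hG : IsExplicit G) (κ : ℝ) :
    ∃ c : ℝ, ∀ k d q : ℕ, 1 ≤ d → Nat.log 2 q = k →
      (G k d).HasParameters q d →
      (G k d).IsGoodSpectralExpander (q ^ d) q →
      ∀ x y w : List Bool, (x, y) ∈ (G k d).E →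
        ∀ N : ℕ, N = x.length + y.length + w.length →
        HasTypicalProfile U κ N q d x y →
        LogEq κ N (condMutualInfo U w y x) 0 →
        LogLE κ N (Real.logb 2 q) (mutualInfo U w x) →
        LogEq c N (condC U x (pairCode y w)) 0 := by
  obtain ⟨c₁, hc₁⟩ := hU.exists_condC_le_length
  obtain ⟨c₂, hc₂⟩ := hU.plainC_pairCode_le
  obtain ⟨c₃, hc₃⟩ := hU.condC_le_plainC
  obtain ⟨c₄, hc₄⟩ := hU.exists_mixing_profile hG
  obtain ⟨K, hK⟩ := exists_nat_ge κ
  -- From (d+1)n ≲ C(y) ≤ |y| + c₁ it follows that (d+1)n ≤ (1 + c₁ + K)(N+2), and d + 3 ≤ 3(d+1).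
  -- So D(N+2) bounds all the numbers used as parameters, and their binary lengths are at most
  -- σ·log(N+2).
  set D : ℕ := 3 * (1 + c₁ + K) with hD
  set σ : ℕ := D.size + 2 with hσ
  refine ⟨((6 + 3 * K + 100 * σ + 3 * c₄ + c₂ + c₃ : ℕ) : ℝ), ?_⟩
  rintro k d q hd rfl hpar hexp x y w hxy N hN ⟨⟨hx1, -⟩, ⟨-, hy2⟩, ⟨-, hxy2⟩⟩ ⟨hI, -⟩ hM
  have hℓ1 := one_le_logb_add_two N
  have hℓ2 := logb_add_two_le N
  have hsizeN : (((N + 2 : ℕ).size : ℕ) : ℝ) ≤ Real.logb 2 ((N : ℝ) + 2) + 1 := by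
    have := size_le_logb_add_one (n := N + 2) (by omega)
    push_cast at this ⊢
    exact this
  simp only [LogEq, LogLE, condMutualInfo, mutualInfo] at hx1 hy2 hxy2 hI hM ⊢
  set ℓ := Real.logb 2 ((N : ℝ) + 2) with hℓ
  set n := Real.logb 2 (q : ℝ) with hn
  have hKℓ : κ * ℓ ≤ K * ℓ := mul_le_mul_of_nonneg_right hK (by linarith)
  have hc0 : (0 : ℝ) ≤ ((6 + 3 * K + 100 * σ + 3 * c₄ + c₂ + c₃ : ℕ) : ℝ) := Nat.cast_nonneg _
  refine ⟨?_, by positivity⟩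
  push_cast
  have hσℓ : (0 : ℝ) ≤ σ * ℓ := by positivity
  have hKℓ0 : (0 : ℝ) ≤ K * ℓ := by positivity
  have hcℓ : ∀ c : ℕ, (c : ℝ) ≤ c * ℓ := fun c => le_mul_of_one_le_right (Nat.cast_nonneg c) hℓ1
  have e₂ := hcℓ c₂
  have e₃ := hcℓ c₃
  have e₄ := hcℓ c₄
  -- For q ≤ 1 there is no spectral gap, but n = 0 (for q = 0 by the convention log 0 = 0), so C(x)
  -- itself is already O(log N).
  rcases Nat.lt_or_ge q 2 with hq | hq
  · have hn0 : n = 0 := by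
      rw [hn]
      interval_cases q <;> simp
    have h1 : (condC U x (pairCode y w) : ℝ) ≤ plainC U x + c₃ := by exact_mod_cast hc₃ x _
    have : (0 : ℝ) ≤ c₄ := Nat.cast_nonneg _
    nlinarith
  · obtain ⟨m, t, r, hm, ht, hdisj, hs⟩ := hc₄ _ d q hd hq hpar hexp x y w hxy
    set a := condC U x w with ha
    have hq0 : (0 : ℝ) < q := by positivity
    have hn1 : 1 ≤ n := by
      rw [hn, Real.le_logb_iff_rpow_le (by norm_num) hq0, Real.rpow_one]
      exact_mod_cast hq
    have hk := natLog_le_logb q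
    rw [← hn] at hk
    have hcy : (plainC U y : ℝ) ≤ N + c₁ := by
      have := hc₁ y []
      exact_mod_cast (this.trans (by omega) : plainC U y ≤ N + c₁)
    have hNK : (K : ℝ) * ℓ ≤ K * (N + 2) := mul_le_mul_of_nonneg_left hℓ2 (Nat.cast_nonneg K)
    have hdn : ((d : ℝ) + 1) * n ≤ (1 + c₁ + K) * (N + 2) := by
      have h1 : (c₁ : ℝ) ≤ c₁ * (N + 2) :=
        le_mul_of_one_le_right (Nat.cast_nonneg _) (by linarith)
      linarith
    have hd1 : (1 : ℝ) ≤ d := by exact_mod_cast hd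
    have hdn' : ((d : ℝ) + 3) * n ≤ D * (N + 2) := by
      have : (D : ℝ) = 3 * (1 + c₁ + K) := by rw [hD]; push_cast; ring
      rw [this]
      have := mul_nonneg (sub_nonneg.2 hd1) (sub_nonneg.2 hn1)
      linarith
    have small : ∀ j : ℕ, (j : ℝ) ≤ D * (N + 2) → j.size ≤ D.size + (N + 2).size := by
      intro j hj
      have h1 : j ≤ D * (N + 2) := by exact_mod_cast hj
      rw [Nat.size_le, pow_add]
      exact h1.trans_lt (Nat.mul_lt_mul'' (Nat.lt_size_self D) (Nat.lt_size_self _))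
    have small' : ∀ j : ℕ, j ≤ N + c₁ → j.size ≤ D.size + (N + 2).size := by
      intro j hj
      refine small j ?_
      have h1 : N + c₁ ≤ D * (N + 2) := by
        rw [hD]
        nlinarith
      exact_mod_cast hj.trans h1
    set s := D.size + (N + 2).size with hs_def
    have hsσ : (s : ℝ) ≤ σ * ℓ := by
      have h1 := hcℓ D.size
      rw [hs_def, hσ]
      push_cast at hsizeN ⊢
      linarith
    have hm' := le_mul_logb_of_two_pow_le hm
    have ht' := le_mul_logb_of_two_pow_le ht
    rw [← hn] at hm' ht'
    push_cast at hm' ht'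
    have hks : (Nat.log 2 q).size ≤ s :=
      small _ ((hk.trans (le_mul_of_one_le_left (by linarith) (by linarith))).trans hdn')
    have hds : d.size ≤ s :=
      small _ ((le_trans (by linarith) (le_mul_of_one_le_right (by linarith) hn1)).trans hdn')
    have has : a.size ≤ s := small' _ ((hc₁ x w).trans (by omega))
    have hms : m.size ≤ s := small _ (by linarith)
    have hts : t.size ≤ s := small _ (by linarith)
    obtain ⟨b1, b2, b3⟩ := hs s hks hds has hms hts
    have b4 := hc₂ x y s (small' _ ((hc₁ x []).trans (by omega)))
      (small' _ ((hc₁ y x).trans (by omega)))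
    have b1' : (condC U x (pairCode y w) : ℝ) ≤ m + 32 * s + c₄ := by exact_mod_cast b1
    have b2' : (condC U y (pairCode w x) : ℝ) ≤ t + 32 * s + c₄ := by exact_mod_cast b2
    have b3' : (a : ℝ) ≤ r + 32 * s + c₄ := by exact_mod_cast b3
    have b4' : (plainC U (pairCode x y) : ℝ) ≤ plainC U x + condC U y x + 4 * s + c₂ := by
      exact_mod_cast b4
    -- The second case is the costly one: 32s each from the bounds by r and t and 4s from the chain
    -- rule make 68, and three hypotheses contribute Kℓ each. Adding the 32s of the bound by m gives
    -- the 100 in the final constant.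
    have hkey : (m : ℝ) ≤ 3 + 3 * (K * ℓ) + 68 * (σ * ℓ) + 2 * c₄ + c₂ := by
      have : (0 : ℝ) ≤ c₄ := Nat.cast_nonneg _
      have : (0 : ℝ) ≤ c₂ := Nat.cast_nonneg _
      rcases logb_mixing_bound (by omega) hdisj with h | h <;> rw [← hn] at h <;> linarith
    have hℓ6 : (6 : ℝ) ≤ 6 * ℓ := by linarith
    linarith
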